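/- Let $K$ be a field of characteristic zero. Let $\mathrm{Sp}_4=\mathrm{Sp}_4(K)$ be the symplectic group of a $4$-dimensional space with symplectic basis $e_1,e_2,f_1,f_2$, let $\mathrm{Sp}_2=\mathrm{Sp}_2(K)$, and let $\mathrm{Sp}_2\wr \mathbb S_2=(\mathrm{Sp}_2\times\mathrm{Sp}_2)\rtimes \mathbb S_2$ be embedded in $\mathrm{Sp}_4$ as the subgroup preserving the unordered orthogonal decomposition $\{\langle e_1,f_1\rangle,\langle e_2,f_2\rangle\}$. For $a\ge 0$ let $V_a=\mathrm{Sym}^a(K^2)$ be the irreducible representation of $\mathrm{Sp}_2$ with highest weight $a$. For $a,b\ge 0$ let $U_{a,b}$ be the representation of $\mathrm{Sp}_2\wr\mathbb S_2$ on $(V_a\otimes V_b)\oplus(V_b\otimes V_a)$ in which the transposition $\sigma\in \mathbb S_2$ acts by $\sigma(x\otimes y,\,y'\otimes x')=(x'\otimes y',\,y\otimes x)$, and let $U_a^{\pm}$ be the representation on $V_a\otimes V_a$ in which $\sigma(x\otimes y)=\pm\, y\otimes x$. For integers $l\ge m\ge 0$ let $W_{l,m}$ be the irreducible representation of $\mathrm{Sp}_4$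 with highest weight $(l,m)$, realized as the subrepresentation of $\mathrm{Sym}(K^4\oplus K^4)$ generated by the highest weight vector $e_1^{\,l-m}(e_1e_2'-e_2e_1')^m$, where $e_i, e_i'$ are the basis vectors $e_i$ of the two copies of $K^4$. Let $l\ge m\ge 0$ be integers. If $l+m$ is even, then \[ \mathrm{Res}^{\mathrm{Sp}_4}_{\mathrm{Sp}_2\wr \mathbb S_2} W_{l,m}\;\cong\; \bigoplus_{0\le i\le m}\Bigl(U_{(l-m)/2+i}^{(-1)^m}\;\oplus\bigoplus_{0\le j<(l-m)/2}U_{l-m+i-j,\;i+j}\Bigr), \] where $(-1)^m$ denotes $+$ if $m$ is even and $-$ if $m$ is odd. If $l+m$ is odd, then \[ \mathrm{Res}^{\mathrm{Sp}_4}_{\mathrm{Sp}_2\wr \mathbb S_2} W_{l,m}\;\cong\; \bigoplus_{0\le i\le m}\;\bigoplus_{0\le j<(l-m)/2}U_{l-m+i-j,\;i+j}. \] -/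

import Mathlib

open scoped TensorProduct DirectSum Kronecker

noncomputable section

namespace SpBranching

variable (K : Type*) [Field K]

/-- `Sp₂(K)`, the symplectic group of a symplectic plane. -/
abbrev Sp2 := Matrix.symplecticGroup (Fin 1) K

/-- `Sp₄(K)`, acting on the space with symplectic basis `e₁, e₂, f₁, f₂`, where
`eᵢ` has index `Sum.inl (i - 1)` and `fᵢ` has index `Sum.inr (i - 1)`. -/
abbrev Sp4 := Matrix.symplecticGroup (Fin 2) K

/-- The wreath product `Sp₂ ≀ S₂ = (Sp₂ × Sp₂) ⋊ S₂`; a permutation `σ` sends `(gᵢ)ᵢ` to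
`(g_{σ⁻¹ i})ᵢ`. -/
abbrev Wr := (Fin 2 → Sp2 K) ⋊[mulAutArrow] Equiv.Perm (Fin 2)

/-! ### The embedding of the wreath product in `Sp₄` -/

variable {K}

/-- The matrix of `(g₀, g₁) ∈ Sp₂ × Sp₂` acting on the orthogonal sum
`⟨e₁, f₁⟩ ⊕ ⟨e₂, f₂⟩`. -/
def blockMatrix (g : Fin 2 → Sp2 K) : Matrix (Fin 2 ⊕ Fin 2) (Fin 2 ⊕ Fin 2) K :=
  Matrix.fromBlocks
    (Matrix.diagonal fun i => (g i).1 (.inl 0) (.inl 0))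
    (Matrix.diagonal fun i => (g i).1 (.inl 0) (.inr 0))
    (Matrix.diagonal fun i => (g i).1 (.inr 0) (.inl 0))
    (Matrix.diagonal fun i => (g i).1 (.inr 0) (.inr 0))

/-- The matrix of the permutation `eᵢ ↦ e_{σ i}`, `fᵢ ↦ f_{σ i}`. -/
def permMatrix (σ : Equiv.Perm (Fin 2)) : Matrix (Fin 2 ⊕ Fin 2) (Fin 2 ⊕ Fin 2) K :=
  Matrix.fromBlocks (σ⁻¹.permMatrix K) 0 0 (σ⁻¹.permMatrix K)

lemma sp2_det (g : Sp2 K) :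
    g.1 (.inl 0) (.inl 0) * g.1 (.inr 0) (.inr 0)
      - g.1 (.inr 0) (.inl 0) * g.1 (.inl 0) (.inr 0) = 1 := by
  have h := g.2
  rw [← Matrix.fromBlocks_toBlocks g.1, SymplecticGroup.fromBlocks_mem_iff] at h
  have h3 := congrFun (congrFun h.2.2 0) 0
  simpa [Matrix.mul_apply, Matrix.toBlocks₁₁, Matrix.toBlocks₁₂, Matrix.toBlocks₂₁,
    Matrix.toBlocks₂₂] using h3

lemma blockMatrix_mem (g : Fin 2 → Sp2 K) :
    blockMatrix g ∈ Matrix.symplecticGroup (Fin 2) K := by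
  rw [blockMatrix, SymplecticGroup.fromBlocks_mem_iff]
  refine ⟨?_, ?_, ?_⟩
  · simp [Matrix.diagonal_mul_diagonal, mul_comm]
  · simp [Matrix.diagonal_mul_diagonal, mul_comm]
  · simp [Matrix.diagonal_mul_diagonal, sp2_det]

lemma permMatrix_mem (σ : Equiv.Perm (Fin 2)) :
    (permMatrix σ : Matrix _ _ K) ∈ Matrix.symplecticGroup (Fin 2) K := by
  rw [permMatrix, SymplecticGroup.fromBlocks_mem_iff]
  refine ⟨by simp, by simp, ?_⟩
  rw [Matrix.transpose_permMatrix, ← Matrix.permMatrix_mul]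
  simp

/-- `Sp₂ × Sp₂ → Sp₄`. -/
def blockHom : (Fin 2 → Sp2 K) →* Sp4 K where
  toFun g := ⟨blockMatrix g, blockMatrix_mem g⟩
  map_one' := by
    apply Subtype.ext
    simp [blockMatrix, Matrix.fromBlocks_one]
  map_mul' g h := by
    apply Subtype.ext
    simp [blockMatrix, Matrix.fromBlocks_multiply, Matrix.mul_apply]

/-- `S₂ → Sp₄`. -/
def permHom : Equiv.Perm (Fin 2) →* Sp4 K where
  toFun σ := ⟨permMatrix σ, permMatrix_mem σ⟩
  map_one' := by
    apply Subtype.ext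
    simp [permMatrix, Matrix.fromBlocks_one]
  map_mul' σ τ := by
    apply Subtype.ext
    simp [permMatrix, Matrix.fromBlocks_multiply, Matrix.permMatrix_mul]

lemma block_perm_comm (σ : Equiv.Perm (Fin 2)) (g : Fin 2 → Sp2 K) :
    blockHom (mulAutArrow σ g) * permHom σ = permHom σ * blockHom g := by
  apply Subtype.ext
  have h : ∀ d : Fin 2 → K,
      Matrix.diagonal (fun i => d (σ⁻¹ i)) * (σ⁻¹).permMatrix K
        = (σ⁻¹).permMatrix K * Matrix.diagonal d := by
    intro d
    ext i j
    rw [Matrix.diagonal_mul, Matrix.mul_diagonal, Equiv.Perm.permMatrix,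
      PEquiv.toMatrix_apply]
    by_cases hij : σ⁻¹ i = j
    · subst hij
      simp
    · have hij' : ¬ σ.symm i = j := hij
      simp [hij']
  simp only [blockHom, permHom, MonoidHom.coe_mk, OneHom.coe_mk, Submonoid.coe_mul,
    blockMatrix, permMatrix, Matrix.fromBlocks_multiply, Matrix.mul_zero, Matrix.zero_mul,
    add_zero, zero_add]
  refine Matrix.fromBlocks_inj.2 ⟨?_, ?_, ?_, ?_⟩
  · exact h fun i => (g i).1 (.inl 0) (.inl 0)
  · exact h fun i => (g i).1 (.inl 0) (.inr 0)
  · exact h fun i => (g i).1 (.inr 0) (.inl 0)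
  · exact h fun i => (g i).1 (.inr 0) (.inr 0)

/-- The embedding `Sp₂ ≀ S₂ → Sp₄`, onto the stabilizer of the unordered orthogonal decomposition
`{⟨e₁, f₁⟩, ⟨e₂, f₂⟩}`. -/
def wrHom : Wr K →* Sp4 K :=
  SemidirectProduct.lift blockHom permHom fun σ => by
    ext1 g
    have := block_perm_comm σ g
    simpa [MulAut.conj_apply, eq_mul_inv_iff_mul_eq] using this

/-! ### The representations `V_a` of `Sp₂` -/

variable (K) in
/-- The action of square matrices on `Sym (K^n) = K[Xᵢ : i ∈ n]` extending the standard action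
on linear forms, `M · Xⱼ = ∑ᵢ Mᵢⱼ Xᵢ`, multiplicatively. -/
def symRep (n : Type*) [Fintype n] [DecidableEq n] :
    Representation K (Matrix n n K) (MvPolynomial n K) where
  toFun M := (MvPolynomial.aeval fun j =>
    ∑ i, MvPolynomial.C (M i j) * MvPolynomial.X i).toLinearMap
  map_one' := by
    have : (fun j : n => ∑ i, MvPolynomial.C ((1 : Matrix n n K) i j) * MvPolynomial.X i)
        = (MvPolynomial.X : n → MvPolynomial n K) := by
      funext j
      simp [Matrix.one_apply]
    rw [this, MvPolynomial.aeval_X_left]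
    rfl
  map_mul' M N := by
    rw [Module.End.mul_eq_comp, ← AlgHom.comp_toLinearMap]
    refine congrArg AlgHom.toLinearMap ?_
    apply MvPolynomial.algHom_ext
    intro j
    simp only [MvPolynomial.aeval_X, AlgHom.comp_apply, map_sum, map_mul, MvPolynomial.algHom_C,
      MvPolynomial.algebraMap_eq, Matrix.mul_apply, Finset.sum_mul, Finset.mul_sum]
    rw [Finset.sum_comm]
    refine Finset.sum_congr rfl fun i _ => Finset.sum_congr rfl fun k _ => ?_
    ring

lemma symRep_isHomogeneous {n : Type*} [Fintype n] [DecidableEq n] (M : Matrix n n K) {d : ℕ}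
    {p : MvPolynomial n K} (hp : p.IsHomogeneous d) : (symRep K n M p).IsHomogeneous d := by
  have h : ∀ j, (∑ i, MvPolynomial.C (M i j) * MvPolynomial.X i :
      MvPolynomial n K).IsHomogeneous 1 := fun j =>
    MvPolynomial.IsHomogeneous.sum _ _ _ fun i _ => by
      simpa using (MvPolynomial.isHomogeneous_C n (M i j)).mul (MvPolynomial.isHomogeneous_X K i)
  have := hp.aeval (fun j => ∑ i, MvPolynomial.C (M i j) * MvPolynomial.X i) h
  rw [mul_comm, mul_one] at this
  exact this

variable (K) in
/-- The space of `V_a`: binary forms of degree `a`, that is, `Sym^a` of the plane. -/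
abbrev VSpace (a : ℕ) : Submodule K (MvPolynomial (Fin 1 ⊕ Fin 1) K) :=
  MvPolynomial.homogeneousSubmodule (Fin 1 ⊕ Fin 1) K a

variable (K) in
/-- The irreducible representation `V_a = Sym^a(K²)` of `Sp₂`. -/
def V (a : ℕ) : Representation K (Sp2 K) (VSpace K a) :=
  Representation.subrepresentation
    ((symRep K (Fin 1 ⊕ Fin 1)).comp (Matrix.symplecticGroup (Fin 1) K).subtype) (VSpace K a)
    fun g _ hp => symRep_isHomogeneous g.1 hp

/-! ### The irreducible representations of `Sp₂ ≀ S₂` -/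

/-- A representation `ρ` of `Sp₂ × Sp₂` together with an involution `T` of its space satisfying
`T ρ(g₀, g₁) = ρ(g₁, g₀) T` gives a representation of `Sp₂ ≀ S₂` in which the transposition acts
as `T`. -/
def wrRep {X : Type*} [AddCommMonoid X] [Module K X]
    (ρ : Representation K (Fin 2 → Sp2 K) X) (T : X →ₗ[K] X) (hT : T * T = 1)
    (hρ : ∀ g : Fin 2 → Sp2 K, T * ρ g = ρ (fun i => g (Equiv.swap 0 1 i)) * T) :
    Representation K (Wr K) X where
  toFun x := ρ x.left * (if x.right = 1 then 1 else T)
  map_one' := by simp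
  map_mul' x y := by
    have key : ∀ σ : Equiv.Perm (Fin 2), σ = 1 ∨ σ = Equiv.swap 0 1 := by decide
    have hne : (Equiv.swap 0 1 : Equiv.Perm (Fin 2)) ≠ 1 := by decide
    have hsw : mulAutArrow (Equiv.swap (0 : Fin 2) 1) y.left
        = fun i => y.left (Equiv.swap 0 1 i) := by
      funext i
      rfl
    rw [SemidirectProduct.mul_left, SemidirectProduct.mul_right, map_mul]
    rcases key x.right with hx | hx <;> rcases key y.right with hy | hy
    · simp [hx, hy]
    · simp [hx, hy, hne, mul_assoc]
    · rw [hx, hy, hsw]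
      simp [hne, mul_assoc, hρ]
    · rw [hx, hy, hsw]
      have : ρ x.left * T * (ρ y.left * T)
          = ρ x.left * ρ (fun i => y.left (Equiv.swap 0 1 i)) := by
        rw [mul_assoc, ← mul_assoc T, hρ, mul_assoc, hT, mul_one]
      simp [hne, this]

variable (K) in
/-- The external tensor product `V_a ⊗ V_b` as a representation of `Sp₂ × Sp₂`. -/
def VV (a b : ℕ) : Representation K (Fin 2 → Sp2 K) (VSpace K a ⊗[K] VSpace K b) :=
  Representation.tprod ((V K a).comp (Pi.evalMonoidHom _ 0)) ((V K b).comp (Pi.evalMonoidHom _ 1))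

lemma comm_VV (a b : ℕ) (g : Fin 2 → Sp2 K) :
    (TensorProduct.comm K (VSpace K a) (VSpace K b)).toLinearMap ∘ₗ VV K a b g
      = VV K b a (fun i => g (Equiv.swap 0 1 i)) ∘ₗ
        (TensorProduct.comm K (VSpace K a) (VSpace K b)).toLinearMap := by
  apply TensorProduct.ext'
  intro x y
  simp [VV]

variable (K) in
/-- The involution `(x ⊗ y, y' ⊗ x') ↦ (x' ⊗ y', y ⊗ x)` of `V_a ⊗ V_b ⊕ V_b ⊗ V_a`. -/
def swapU (a b : ℕ) :
    ((VSpace K a ⊗[K] VSpace K b) × (VSpace K b ⊗[K] VSpace K a)) →ₗ[K]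
      ((VSpace K a ⊗[K] VSpace K b) × (VSpace K b ⊗[K] VSpace K a)) :=
  LinearMap.prod
    ((TensorProduct.comm K (VSpace K b) (VSpace K a)).toLinearMap ∘ₗ LinearMap.snd K _ _)
    ((TensorProduct.comm K (VSpace K a) (VSpace K b)).toLinearMap ∘ₗ LinearMap.fst K _ _)

lemma swapU_mul_self (a b : ℕ) : swapU K a b * swapU K a b = 1 := by
  apply LinearMap.ext
  rintro ⟨p, q⟩
  simp [swapU]

lemma swapU_comm (a b : ℕ) (g : Fin 2 → Sp2 K) :
    swapU K a b * (VV K a b).prod (VV K b a) g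
      = (VV K a b).prod (VV K b a) (fun i => g (Equiv.swap 0 1 i)) * swapU K a b := by
  apply LinearMap.ext
  rintro ⟨p, q⟩
  exact Prod.ext (LinearMap.congr_fun (comm_VV b a g) q) (LinearMap.congr_fun (comm_VV a b g) p)

variable (K) in
/-- `U_{a,b}`: the space `V_a ⊗ V_b ⊕ V_b ⊗ V_a`, where the transposition acts by
`(x ⊗ y, y' ⊗ x') ↦ (x' ⊗ y', y ⊗ x)`. -/
def U (a b : ℕ) : Representation K (Wr K)
    ((VSpace K a ⊗[K] VSpace K b) × (VSpace K b ⊗[K] VSpace K a)) :=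
  wrRep ((VV K a b).prod (VV K b a)) (swapU K a b) (swapU_mul_self a b) (swapU_comm a b)

variable (K) in
/-- The involution `x ⊗ y ↦ ε (y ⊗ x)` of `V_a ⊗ V_a`, for a sign `ε`. -/
def swapSign (ε : ℤˣ) (a : ℕ) :
    (VSpace K a ⊗[K] VSpace K a) →ₗ[K] (VSpace K a ⊗[K] VSpace K a) :=
  (ε : ℤ) • (TensorProduct.comm K (VSpace K a) (VSpace K a)).toLinearMap

lemma swapSign_mul_self (ε : ℤˣ) (a : ℕ) : swapSign K ε a * swapSign K ε a = 1 := by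
  rcases Int.units_eq_one_or ε with rfl | rfl <;>
  · apply LinearMap.ext
    intro p
    simp [swapSign, smul_smul]

lemma swapSign_comm (ε : ℤˣ) (a : ℕ) (g : Fin 2 → Sp2 K) :
    swapSign K ε a * VV K a a g
      = VV K a a (fun i => g (Equiv.swap 0 1 i)) * swapSign K ε a := by
  rw [swapSign, smul_mul_assoc, mul_smul_comm]
  exact congrArg _ (comm_VV a a g)

variable (K) in
/-- `U_a^ε` for a sign `ε = ±1`: the space `V_a ⊗ V_a`, where the transposition acts by
`x ⊗ y ↦ ε (y ⊗ x)`. -/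
def USign (ε : ℤˣ) (a : ℕ) : Representation K (Wr K) (VSpace K a ⊗[K] VSpace K a) :=
  wrRep (VV K a a) (swapSign K ε a) (swapSign_mul_self ε a) (swapSign_comm ε a)

/-! ### The representations `W_{l,m}` of `Sp₄` -/

variable (K) in
/-- The action of `Sp₄` on `Sym(W ⊕ W)`, where `W = K⁴` is the defining representation: the
polynomial ring in the variables `X (p, 0)` and `X (p, 1)`, the bases of the two copies of `W`. -/
def symWW : Representation K (Sp4 K) (MvPolynomial ((Fin 2 ⊕ Fin 2) × Fin 2) K) where
  toFun g := symRep K _ (g.1 ⊗ₖ (1 : Matrix (Fin 2) (Fin 2) K))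
  map_one' := by simp
  map_mul' g h := by
    rw [← map_mul, ← Matrix.mul_kronecker_mul, mul_one]
    rfl

variable (K) in
/-- The vector `e₁^(l-m) (e₁ ∧ e₂)^m` for `l ≥ m`, where `e₁` is in the first copy of `W`, and
`e₁ ∧ e₂ ∈ ∧² W` is identified with the minor `X(e₁,0) X(e₂,1) - X(e₂,0) X(e₁,1)`. It is a
highest weight vector of weight `(l, m)`: it is fixed by the unipotent radical of the Borel
subgroup that stabilizes the isotropic flag `⟨e₁⟩ ⊂ ⟨e₁, e₂⟩`, and
`diag(t₁, t₂, t₁⁻¹, t₂⁻¹)` multiplies it by `t₁^l t₂^m`. -/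
def highestVector (l m : ℕ) : MvPolynomial ((Fin 2 ⊕ Fin 2) × Fin 2) K :=
  MvPolynomial.X (.inl 0, 0) ^ (l - m) *
    (MvPolynomial.X (.inl 0, 0) * MvPolynomial.X (.inl 1, 1)
      - MvPolynomial.X (.inl 1, 0) * MvPolynomial.X (.inl 0, 1)) ^ m

/-- The span of the orbit of a vector under a group representation. -/
def orbitSpan {G X : Type*} [Group G] [AddCommGroup X] [Module K X] (ρ : Representation K G X)
    (v : X) : Submodule K X :=
  Submodule.span K (Set.range fun g : G => ρ g v)

lemma orbitSpan_le_comap {G X : Type*} [Group G] [AddCommGroup X] [Module K X]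
    (ρ : Representation K G X) (v : X) (g : G) : orbitSpan ρ v ≤ (orbitSpan ρ v).comap (ρ g) := by
  refine Submodule.span_le.2 ?_
  rintro _ ⟨h, rfl⟩
  refine Submodule.subset_span ⟨g * h, ?_⟩
  simp

variable (K) in
/-- The space of `W_{l,m}`: the subrepresentation generated by the highest weight vector. -/
abbrev WSpace (l m : ℕ) : Submodule K (MvPolynomial ((Fin 2 ⊕ Fin 2) × Fin 2) K) :=
  orbitSpan (symWW K) (highestVector K l m)

variable (K) in
/-- The representation `W_{l,m}` of `Sp₄`, for `l ≥ m`: as the subrepresentation generated by a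
highest weight vector of weight `(l, m)` in a rational representation it is, in characteristic
zero, the irreducible representation with highest weight `(l, m)`. -/
def W (l m : ℕ) : Representation K (Sp4 K) (WSpace K l m) :=
  (symWW K).subrepresentation (WSpace K l m) (orbitSpan_le_comap _ _)

end SpBranching

end

/-! Read Sym(K⁴ ⊕ K⁴) as polynomials in a generic pair of vectors z, w, and let ω be the value of
the symplectic form on the pair. The elements of `WSpace K l m` are killed by the Laplacian Δ
adjoint to multiplication by ω (`symplLaplacian_of_mem_WSpace`), and a polynomial killed by Δ that
lies in the ideal (ω) is zero (`eq_zero_of_mem_span_symplForm`). So nothing is lost modulo ω, where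
the pair may be treated as isotropic.

Put n = l - m. Let X, Y be the linear forms in auxiliary variables whose coefficients are the
components of z in the two planes, M the 2 × 2 minor formed from X, Y and their analogues for w, and
s the contribution of the first plane to ω; modulo ω the second plane contributes -s. For a + b = n
and i ≤ m the coefficients of s^(m-i) X^a Y^b M^i carry a copy of V_{a+i} ⊗ V_{b+i}. Exchanging the
planes exchanges X and Y and negates both M and s, so the transposition acts with the global sign
(-1)^m. The sign is visible only for a = b, where it gives U^±; for a ≠ b it is absorbed by
rescaling one of the two components (`realizes_U`).

Three facts show that these copies make up exactly the image of W. Containment: each translate of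
the highest weight vector is a power of a linear form times a power of a minor, and such products
lie in the span of the coefficients (`pow_mul_pow_mem_genSpan`). Independence: along isotropic pairs
degenerating so that s tends to 0 and M to XY, the lowest order term isolates one value of i
(`eq_zero_of_genMap`). Dimension: on polynomials invariant under w ↦ w + cz, the apolar pairing with
a translate of the highest weight vector is a nonzero multiple of evaluation at a pair of vectors
(`eval_eq_zero_of_apolar`), so the sum of the copies embeds in the dual of W
(`eq_zero_of_apolar_WSpace`). Together they give `map_WSpace_eq`. Neither irreducibility of W nor a
dimension formula is needed. -/

noncomputable section

namespace SpBranching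

open MvPolynomial

/-! ### The apolar pairing -/

section Apolar

variable {σ K Q : Type*} [Field K] [CommRing Q] [Algebra K Q]

/-- The apolar pairing `⟨p, F⟩ = p(∂) F |₀` of polynomials in the same variables, the second one
having coefficients in a `K`-algebra. -/
def apolar : MvPolynomial σ K →ₗ[K] MvPolynomial σ Q →ₗ[K] Q :=
  (basisMonomials σ K).constr K fun κ =>
    ((κ.prod fun _ n => n.factorial : ℕ) : K) • (lcoeff Q κ).restrictScalars K

lemma apolar_monomial (κ : σ →₀ ℕ) (r : K) (F : MvPolynomial σ Q) :
    apolar (monomial κ r) F = r • ((κ.prod fun _ n => n.factorial : ℕ) : K) • coeff κ F := by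
  have h : monomial κ r = r • basisMonomials σ K κ := by
    simp [coe_basisMonomials, smul_monomial]
  rw [h, map_smul, apolar, Module.Basis.constr_basis]
  rfl

lemma apolar_C (r : K) (F : MvPolynomial σ Q) : apolar (C r) F = r • coeff 0 F := by
  have := apolar_monomial 0 r F
  simpa using this

lemma factorial_prod_add_single (κ : σ →₀ ℕ) (i : σ) :
    ((κ + Finsupp.single i 1).prod fun _ n => n.factorial)
      = (κ i + 1) * κ.prod fun _ n => n.factorial := by
  classical
  have h1 : (κ + Finsupp.single i 1).support ⊆ insert i κ.support := by
    intro j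
    simp only [Finsupp.mem_support_iff, Finset.mem_insert, Finsupp.add_apply]
    by_cases hj : j = i
    · simp [hj]
    · simp [hj]
  rw [Finsupp.prod_of_support_subset _ h1 _ (by simp),
    Finsupp.prod_of_support_subset κ (Finset.subset_insert i κ.support) _ (by simp),
    ← Finset.mul_prod_erase _ _ (Finset.mem_insert_self i κ.support),
    ← Finset.mul_prod_erase _ _ (Finset.mem_insert_self i κ.support)]
  have h2 : ∀ j ∈ (insert i κ.support).erase i,
      ((κ + Finsupp.single i 1 : σ →₀ ℕ) j).factorial = (κ j).factorial := by
    intro j hj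
    simp [Ne.symm (Finset.ne_of_mem_erase hj)]
  rw [Finset.prod_congr rfl h2]
  simp [Nat.factorial_succ, mul_assoc]

/-- Multiplication by a variable and differentiation are adjoint. With its mirror image
`apolar_pderiv`, this is the source of the adjunctions for substitutions, polarizations and the
Laplacian. -/
lemma apolar_mul_X (p : MvPolynomial σ K) (i : σ) (F : MvPolynomial σ Q) :
    apolar (p * X i) F = apolar p (pderiv i F) := by
  induction p using MvPolynomial.induction_on' with
  | add p q hp hq => simp [add_mul, hp, hq]
  | monomial κ r =>
    rw [X, monomial_mul, mul_one, apolar_monomial, apolar_monomial, factorial_prod_add_single,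
      coeff_pderiv]
    congr 1
    simp only [Algebra.smul_def, map_natCast, Nat.cast_mul, Nat.cast_add, Nat.cast_one,
      map_mul, map_add, map_one]
    ring

lemma apolar_pderiv (p : MvPolynomial σ K) (i : σ) (F : MvPolynomial σ Q) :
    apolar (pderiv i p) F = apolar p (F * X i) := by
  classical
  induction p using MvPolynomial.induction_on' with
  | add p q hp hq => simp [hp, hq]
  | monomial κ r =>
    rw [pderiv_monomial, apolar_monomial, apolar_monomial, coeff_mul_X']
    by_cases h : κ i = 0
    · simp [h]
    · have hi : i ∈ κ.support := by simpa using h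
      have hκ : κ = (κ - Finsupp.single i 1) + Finsupp.single i 1 := by
        rw [tsub_add_cancel_of_le]
        rw [Finsupp.single_le_iff]
        omega
      rw [if_pos hi]
      conv_rhs => rw [hκ, factorial_prod_add_single]
      have h2 : (κ - Finsupp.single i 1 : σ →₀ ℕ) i + 1 = κ i := by
        simp
        omega
      rw [h2]
      simp only [← hκ, smul_smul]
      push_cast
      ring_nf

lemma apolar_C_mul (p : MvPolynomial σ K) (a : Q) (F : MvPolynomial σ Q) :
    apolar p (C a * F) = a * apolar p F := by
  induction p using MvPolynomial.induction_on' with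
  | add p q hp hq => simp [hp, hq, mul_add]
  | monomial κ r => simp [apolar_monomial]

lemma map_apolar {Q' : Type*} [CommRing Q'] [Algebra K Q'] (φ : Q →ₐ[K] Q')
    (p : MvPolynomial σ K) (F : MvPolynomial σ Q) :
    φ (apolar p F) = apolar p (MvPolynomial.map φ.toRingHom F) := by
  induction p using MvPolynomial.induction_on' with
  | add p q hp hq => simp [hp, hq]
  | monomial κ r => simp [apolar_monomial, coeff_map]

lemma apolar_comm (p F : MvPolynomial σ K) : apolar p F = apolar F p := by
  induction p using MvPolynomial.induction_on' with
  | add p q hp hq => simp [hp, hq]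
  | monomial κ r =>
    classical
    induction F using MvPolynomial.induction_on' with
    | add p q hp hq => simp [hp, hq]
    | monomial κ' r' =>
      rw [apolar_monomial, apolar_monomial, coeff_monomial, coeff_monomial]
      by_cases h : κ = κ'
      · subst h
        simp
        ring
      · simp [h, Ne.symm h]

lemma apolar_mem (p : MvPolynomial σ K) {F : MvPolynomial σ Q} {M : Submodule K Q}
    (h : F ∈ coeffsIn σ M) : apolar p F ∈ M := by
  induction p using MvPolynomial.induction_on' with
  | add p q hp hq => simpa using M.add_mem hp hq
  | monomial κ r =>
    rw [apolar_monomial]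
    exact M.smul_mem _ (M.smul_mem _ (h κ))

lemma eq_zero_of_apolar [CharZero K] {F : MvPolynomial σ K}
    (h : ∀ p : MvPolynomial σ K, apolar p F = 0) :
    F = 0 := by
  ext κ
  have := h (monomial κ 1)
  rw [apolar_monomial, one_smul, smul_eq_mul, mul_eq_zero] at this
  rcases this with h0 | h0
  · rw [Nat.cast_eq_zero, Finsupp.prod, Finset.prod_eq_zero_iff] at h0
    obtain ⟨j, -, hj⟩ := h0
    exact absurd hj (Nat.factorial_ne_zero _)
  · simpa using h0

variable [Fintype σ]

/-- The substitution `X j ↦ ∑ i, N i j • X i` on polynomials with coefficients in a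
`K`-algebra. -/
def linSubst (Q : Type*) [CommRing Q] [Algebra K Q] (N : Matrix σ σ K) :
    MvPolynomial σ Q →ₐ[Q] MvPolynomial σ Q :=
  aeval fun j => ∑ i, N i j • X i

lemma linSubst_X (N : Matrix σ σ K) (j : σ) :
    linSubst Q N (X j) = ∑ i, N i j • X i := by
  simp [linSubst]

lemma linSubst_C (N : Matrix σ σ K) (a : Q) : linSubst Q N (C a) = C a := by
  simp [linSubst, algebraMap_eq]

lemma symRep_eq_linSubst [DecidableEq σ] (N : Matrix σ σ K) (p : MvPolynomial σ K) :
    symRep K σ N p = linSubst K N p := by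
  simp [symRep, linSubst, smul_eq_C_mul]

lemma pderiv_linSubst (N : Matrix σ σ K) (i : σ) (F : MvPolynomial σ Q) :
    pderiv i (linSubst Q N F) = ∑ j, N i j • linSubst Q N (pderiv j F) := by
  classical
  induction F using MvPolynomial.induction_on with
  | C a => simp
  | add p q hp hq => simp [hp, hq, Finset.sum_add_distrib]
  | mul_X p k hp =>
    have h1 : pderiv i (linSubst Q N (X k)) = algebraMap K _ (N i k) := by
      have h2 : ∀ j, N j k • (X j : MvPolynomial σ Q) = C (algebraMap K Q (N j k)) * X j := by
        intro j
        rw [Algebra.smul_def]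
        rfl
      simp only [linSubst_X, map_sum, h2, pderiv_C_mul, pderiv_X]
      rw [Finset.sum_eq_single i]
      · simp
      · intro j _ hj
        simp [hj]
      · simp
    rw [map_mul, pderiv_mul, hp, h1]
    have h3 : ∀ j, N i j • linSubst Q N (pderiv j (p * X k))
        = (N i j • linSubst Q N (pderiv j p)) * linSubst Q N (X k)
          + (N i j * (Pi.single (M := fun _ => K) j 1 k)) • linSubst Q N p := by
      intro j
      rw [pderiv_mul, map_add, map_mul, smul_add, smul_mul_assoc]
      congr 1
      rw [pderiv_X]
      by_cases hj : k = j
      · subst hj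
        simp
      · simp [hj]
    rw [Finset.sum_congr rfl fun j _ => h3 j, Finset.sum_add_distrib, ← Finset.sum_mul,
      ← Finset.sum_smul]
    congr 1
    have h4 : ∑ j, N i j * (Pi.single (M := fun _ => K) j 1 k) = N i k := by
      rw [Finset.sum_eq_single k]
      · simp
      · intro j _ hj
        simp [Ne.symm hj]
      · simp
    rw [h4, mul_comm, Algebra.smul_def]

lemma coeff_zero_linSubst (N : Matrix σ σ K) (F : MvPolynomial σ Q) :
    coeff 0 (linSubst Q N F) = coeff 0 F := by
  have : (constantCoeff : MvPolynomial σ Q →+* Q).comp (linSubst Q N).toRingHom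
      = constantCoeff := by
    apply MvPolynomial.ringHom_ext
    · intro a
      simp
    · intro j
      simp [linSubst_X, Algebra.smul_def, MvPolynomial.algebraMap_apply]
  exact RingHom.congr_fun this F

/-- The chain rule `pderiv_linSubst` moves the variables of p across the pairing one at a time,
which transposes the matrix. -/
lemma apolar_linSubst (N : Matrix σ σ K) (p : MvPolynomial σ K) (F : MvPolynomial σ Q) :
    apolar (linSubst K N p) F = apolar p (linSubst Q N.transpose F) := by
  induction p using MvPolynomial.induction_on generalizing F with
  | C a => rw [linSubst_C, apolar_C, apolar_C, coeff_zero_linSubst]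
  | add p q hp hq => simp [hp, hq]
  | mul_X p k hp =>
    rw [map_mul, linSubst_X, apolar_mul_X, pderiv_linSubst, Finset.mul_sum]
    simp only [mul_smul_comm, map_sum, map_smul, LinearMap.sum_apply, LinearMap.smul_apply,
      apolar_mul_X, hp, Matrix.transpose_apply]

end Apolar

/-! ### The reproducing property of the apolar pairing -/

section Reproducing

variable {σ K Q : Type*} [Field K] [CommRing Q] [Algebra K Q]

/-- The weight that counts the variables of colour `k`. -/
def colorWeight (c : σ → Fin 2) (k : Fin 2) : σ → ℕ := fun j => if c j = k then 1 else 0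

lemma isWeightedHomogeneous_of_mul_X {w : σ → ℕ} {p : MvPolynomial σ K} {n : σ} {a : ℕ}
    (hp : p ≠ 0) (h : IsWeightedHomogeneous w (p * X n) a) :
    ∃ b, IsWeightedHomogeneous w p b ∧ a = b + w n := by
  have key : ∀ d, coeff d p ≠ 0 → Finsupp.weight w d + w n = a := by
    intro d hd
    have := h (d := d + Finsupp.single n 1) (by rwa [coeff_mul_X])
    simpa [map_add, Finsupp.weight_single] using this
  obtain ⟨d₀, hd₀⟩ := ne_zero_iff.1 hp
  refine ⟨Finsupp.weight w d₀, ?_, (key d₀ hd₀).symm⟩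
  intro d hd
  have := key d hd
  have := key d₀ hd₀
  omega

variable [Fintype σ]

/-- The part of colour `k` of the linear form with coefficients `v`. -/
def linForm (c : σ → Fin 2) (v : σ → Q) (k : Fin 2) : MvPolynomial σ Q :=
  ∑ j, if c j = k then C (v j) * X j else 0

lemma pderiv_linForm (c : σ → Fin 2) (v : σ → Q) (k : Fin 2) (n : σ) :
    pderiv n (linForm c v k) = if c n = k then C (v n) else 0 := by
  classical
  rw [linForm, map_sum, Finset.sum_eq_single n]
  · split_ifs <;> simp
  · intro j _ hj
    split_ifs <;> simp [hj]
  · simp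

lemma coeff_zero_linForm (c : σ → Fin 2) (v : σ → Q) (k : Fin 2) :
    constantCoeff (linForm c v k) = 0 := by
  rw [linForm, map_sum]
  refine Finset.sum_eq_zero fun j _ => ?_
  split_ifs <;> simp

/-- Peel off the variables of the monomial one at a time: differentiating a power of a linear form
in `X n` yields the exponent, the scalar `v n` and one power less. -/
lemma apolar_monomial_linForm (c : σ → Fin 2) (v : σ → Q) (κ : σ →₀ ℕ) (r : K) (a₀ b₀ : ℕ)
    (h₀ : IsWeightedHomogeneous (colorWeight c 0) (monomial κ r) a₀)
    (h₁ : IsWeightedHomogeneous (colorWeight c 1) (monomial κ r) b₀) (a b : ℕ) :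
    apolar (monomial κ r) (linForm c v 0 ^ a * linForm c v 1 ^ b)
      = if a = a₀ ∧ b = b₀ then a.factorial * b.factorial * aeval v (monomial κ r) else 0 := by
  refine induction_on_monomial (motive := fun p => ∀ a₀ b₀ a b : ℕ,
    IsWeightedHomogeneous (colorWeight c 0) p a₀ → IsWeightedHomogeneous (colorWeight c 1) p b₀ →
    apolar p (linForm c v 0 ^ a * linForm c v 1 ^ b)
      = if a = a₀ ∧ b = b₀ then a.factorial * b.factorial * aeval v p else 0)
    ?_ ?_ κ r a₀ b₀ a b h₀ h₁
  · intro r a₀ b₀ a b h₀ h₁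
    by_cases hr : r = 0
    · simp [hr]
    have hC : (C r : MvPolynomial σ K) ≠ 0 := by simpa using hr
    obtain rfl := IsWeightedHomogeneous.inj_right hC (isWeightedHomogeneous_C _ r) h₀
    obtain rfl := IsWeightedHomogeneous.inj_right hC (isWeightedHomogeneous_C _ r) h₁
    rw [apolar_C]
    change r • constantCoeff (linForm c v 0 ^ a * linForm c v 1 ^ b) = _
    rw [map_mul, map_pow, map_pow, coeff_zero_linForm, coeff_zero_linForm]
    rcases Nat.eq_zero_or_pos a with rfl | ha
    · rcases Nat.eq_zero_or_pos b with rfl | hb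
      · simp [Algebra.smul_def]
      · simp [hb.ne']
    · simp [ha.ne']
  · intro p n hp a₀ b₀ a b h₀ h₁
    by_cases hp0 : p = 0
    · simp [hp0]
    obtain ⟨a', ha', rfl⟩ := isWeightedHomogeneous_of_mul_X hp0 h₀
    obtain ⟨b', hb', rfl⟩ := isWeightedHomogeneous_of_mul_X hp0 h₁
    rw [apolar_mul_X, pderiv_mul, pderiv_pow, pderiv_pow, pderiv_linForm, pderiv_linForm]
    have hn : c n = 0 ∨ c n = 1 := by
      generalize c n = x
      revert x
      decide
    rcases hn with hn | hn
    · have e : (a : MvPolynomial σ Q) * linForm c v 0 ^ (a - 1) * (if c n = 0 then C (v n) else 0)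
          * linForm c v 1 ^ b + linForm c v 0 ^ a * ((b : MvPolynomial σ Q) * linForm c v 1 ^ (b - 1) *
          (if c n = 1 then C (v n) else 0))
          = C (a * v n) * (linForm c v 0 ^ (a - 1) * linForm c v 1 ^ b) := by
        simp [hn]
        ring
      rw [e, apolar_C_mul, hp a' b' _ _ ha' hb']
      -- For a = 0 both sides vanish: the factor a kills the left one despite the truncated
      -- exponent, and p * X n has degree at least 1 in colour 0.
      rcases a with _ | a
      · simp [colorWeight, hn]
      · simp only [colorWeight, hn, Nat.factorial_succ]
        by_cases h : a = a' ∧ b = b'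
        · simp [h]
          ring
        · simp [h]
    · have e : (a : MvPolynomial σ Q) * linForm c v 0 ^ (a - 1) * (if c n = 0 then C (v n) else 0)
          * linForm c v 1 ^ b + linForm c v 0 ^ a * ((b : MvPolynomial σ Q) * linForm c v 1 ^ (b - 1) *
          (if c n = 1 then C (v n) else 0))
          = C (b * v n) * (linForm c v 0 ^ a * linForm c v 1 ^ (b - 1)) := by
        simp [hn]
        ring
      rw [e, apolar_C_mul, hp a' b' _ _ ha' hb']
      rcases b with _ | b
      · simp [colorWeight, hn]
      · simp only [colorWeight, hn, Nat.factorial_succ]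
        by_cases h : a = a' ∧ b = b'
        · simp [h]
          ring
        · simp [h]

/-- The reproducing property: on bihomogeneous polynomials, evaluation at v is represented by powers
of the linear forms with coefficients v. It converts orthogonality into vanishing at points. -/
lemma apolar_linForm (c : σ → Fin 2) (v : σ → Q) (p : MvPolynomial σ K) (a b : ℕ)
    (h₀ : IsWeightedHomogeneous (colorWeight c 0) p a)
    (h₁ : IsWeightedHomogeneous (colorWeight c 1) p b) :
    apolar p (linForm c v 0 ^ a * linForm c v 1 ^ b)
      = a.factorial * b.factorial * aeval v p := by
  conv_lhs => rw [p.as_sum]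
  conv_rhs => rw [p.as_sum]
  rw [map_sum, map_sum, LinearMap.sum_apply, Finset.mul_sum]
  refine Finset.sum_congr rfl fun κ hκ => ?_
  have hκ' : coeff κ p ≠ 0 := by simpa using hκ
  rw [apolar_monomial_linForm c v κ _ a b (isWeightedHomogeneous_monomial _ _ _ (h₀ hκ'))
    (isWeightedHomogeneous_monomial _ _ _ (h₁ hκ'))]
  simp

end Reproducing

/-! ### Evaluation at a pair of vectors as an apolar pairing -/

section Slots

variable {ι K : Type*} [Field K] [Fintype ι]

/-- The linear form with coefficients `v` in the variables of the slot `k`. -/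
def slotForm (v : ι → K) (k : Fin 2) : MvPolynomial (ι × Fin 2) K :=
  ∑ j, C (v j) * X (j, k)

/-- The point of `K^ι × K^ι` with components `v` and `w`. -/
def slotPoint {R : Type*} (v w : ι → R) : ι × Fin 2 → R := fun p => ![v p.1, w p.1] p.2

lemma linForm_slotPoint (v w : ι → K) (k : Fin 2) :
    linForm Prod.snd (slotPoint v w) k = slotForm (![v, w] k) k := by
  classical
  rw [linForm, slotForm, Fintype.sum_prod_type]
  refine Finset.sum_congr rfl fun j _ => ?_
  fin_cases k <;> simp [slotPoint]

variable (ι K) in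
/-- The derivation that replaces the variables in slot `k` by those in slot `k'`. -/
def slotDer (k k' : Fin 2) : Derivation K (MvPolynomial (ι × Fin 2) K)
    (MvPolynomial (ι × Fin 2) K) :=
  ∑ j, (X (j, k') : MvPolynomial (ι × Fin 2) K) • pderiv (j, k)

lemma slotDer_apply (k k' : Fin 2) (f : MvPolynomial (ι × Fin 2) K) :
    slotDer ι K k k' f = ∑ j, pderiv (j, k) f * X (j, k') := by
  have : ∀ s : Finset ι, (∑ j ∈ s, (X (j, k') : MvPolynomial (ι × Fin 2) K) • pderiv (R := K) (j, k)) f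
      = ∑ j ∈ s, pderiv (j, k) f * X (j, k') := by
    classical
    intro s
    induction s using Finset.induction_on with
    | empty => simp
    | insert a s ha h =>
      rw [Finset.sum_insert ha, Finset.sum_insert ha, Derivation.add_apply, h]
      simp [mul_comm]
  exact this _

lemma apolar_slotDer (k k' : Fin 2) (p f : MvPolynomial (ι × Fin 2) K) :
    apolar (slotDer ι K k k' p) f = apolar p (slotDer ι K k' k f) := by
  simp only [slotDer_apply, map_sum, LinearMap.sum_apply, apolar_mul_X, apolar_pderiv]

lemma slotDer_X (k k' k'' : Fin 2) (j : ι) :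
    slotDer ι K k k' (X (j, k'')) = if k'' = k then X (j, k') else 0 := by
  classical
  rw [slotDer_apply]
  split_ifs with h
  · subst h
    rw [Finset.sum_eq_single j]
    · simp
    · intro i _ hi
      rw [pderiv_X_of_ne (by simp [Ne.symm hi]), zero_mul]
    · simp
  · refine Finset.sum_eq_zero fun i _ => ?_
    rw [pderiv_X_of_ne (by simp [h]), zero_mul]

lemma slotDer_slotForm (k k' k'' : Fin 2) (v : ι → K) :
    slotDer ι K k k' (slotForm v k'') = if k'' = k then slotForm v k' else 0 := by
  rw [slotForm, map_sum]
  simp only [← smul_eq_C_mul, Derivation.map_smul, slotDer_X]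
  split_ifs with h
  · simp [slotForm, smul_eq_C_mul]
  · simp

/-- The adjoint of `slotDer 0 1` kills f, so the derivative of any product pairs to zero with f.
Here the product is v₀^(a+1) w₀^(k+1) w₁^b v₁^k, whose derivative has just two terms. -/
lemma apolar_slotForm_recursion (v w : ι → K) {f : MvPolynomial (ι × Fin 2) K}
    (hf : slotDer ι K 1 0 f = 0) (a k b : ℕ) :
    (a + 1 : K) * apolar (slotForm v 0 ^ a * slotForm w 0 ^ (k + 1) * slotForm w 1 ^ b
        * slotForm v 1 ^ (k + 1)) f
      = - ((k + 1) * apolar (slotForm v 0 ^ (a + 1) * slotForm w 0 ^ k * slotForm w 1 ^ (b + 1)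
        * slotForm v 1 ^ k) f) := by
  have h := apolar_slotDer 0 1
    (slotForm v 0 ^ (a + 1) * slotForm w 0 ^ (k + 1) * slotForm w 1 ^ b * slotForm v 1 ^ k) f
  rw [hf, map_zero] at h
  have e : slotDer ι K 0 1
      (slotForm v 0 ^ (a + 1) * slotForm w 0 ^ (k + 1) * slotForm w 1 ^ b * slotForm v 1 ^ k)
      = (a + 1 : K) • (slotForm v 0 ^ a * slotForm w 0 ^ (k + 1) * slotForm w 1 ^ b
        * slotForm v 1 ^ (k + 1))
        + (k + 1 : K) • (slotForm v 0 ^ (a + 1) * slotForm w 0 ^ k * slotForm w 1 ^ (b + 1)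
        * slotForm v 1 ^ k) := by
    simp only [Derivation.leibniz, Derivation.leibniz_pow, slotDer_slotForm, smul_eq_mul,
      nsmul_eq_mul, smul_eq_C_mul]
    simp
    ring
  rw [e, map_add, LinearMap.add_apply, map_smul, map_smul, LinearMap.smul_apply,
    LinearMap.smul_apply, smul_eq_mul, smul_eq_mul] at h
  exact eq_neg_of_add_eq_zero_left h

variable [CharZero K]

/-- Iterating the recursion reduces every term in the binomial expansion of the minor to the single
pairing with v₀^l w₁^m. -/
lemma choose_mul_apolar_slotForm (v w : ι → K) {f : MvPolynomial (ι × Fin 2) K}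
    (hf : slotDer ι K 1 0 f = 0) {l m : ℕ} (hml : m ≤ l) (k : ℕ) (hk : k ≤ m) :
    (l.choose k : K) * apolar (slotForm v 0 ^ (l - k) * slotForm w 0 ^ k * slotForm w 1 ^ (m - k)
        * slotForm v 1 ^ k) f
      = (-1) ^ k * apolar (slotForm v 0 ^ l * slotForm w 1 ^ m) f := by
  induction k with
  | zero => simp
  | succ k ih =>
    specialize ih (by omega)
    have h := apolar_slotForm_recursion v w hf (l - (k + 1)) k (m - (k + 1))
    rw [show l - (k + 1) + 1 = l - k by omega, show m - (k + 1) + 1 = m - k by omega] at h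
    have hc : (l.choose (k + 1) : K) * (k + 1) = l.choose k * ((l - (k + 1) : ℕ) + 1) := by
      have := Nat.choose_succ_right_eq l k
      rw [show l - k = l - (k + 1) + 1 by omega] at this
      exact_mod_cast this
    have hk0 : (k + 1 : K) ≠ 0 := by exact_mod_cast Nat.succ_ne_zero k
    apply mul_left_cancel₀ hk0
    rw [← mul_assoc, mul_comm (k + 1 : K), hc, mul_assoc, h, pow_succ]
    linear_combination (-(k + 1 : K)) * ih

/-- The signs of the binomial expansion cancel those of `choose_mul_apolar_slotForm`, so the pairing
is ∑ C(m,k)/C(l,k) times the pairing with v₀^l w₁^m. The sum is a positive rational, and the last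
pairing is l! m! f(v, w) by the reproducing property. -/
lemma eval_eq_zero_of_apolar (v w : ι → K) {f : MvPolynomial (ι × Fin 2) K}
    (hf : slotDer ι K 1 0 f = 0) {l m : ℕ} (hml : m ≤ l)
    (h₀ : IsWeightedHomogeneous (colorWeight Prod.snd 0) f l)
    (h₁ : IsWeightedHomogeneous (colorWeight Prod.snd 1) f m)
    (h : apolar (slotForm v 0 ^ (l - m) *
      (slotForm v 0 * slotForm w 1 - slotForm w 0 * slotForm v 1) ^ m) f = 0) :
    eval (slotPoint v w) f = 0 := by
  have e : slotForm v 0 ^ (l - m) *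
      (slotForm v 0 * slotForm w 1 - slotForm w 0 * slotForm v 1) ^ m
      = ∑ k ∈ Finset.range (m + 1), ((-1) ^ k * (m.choose k : K)) •
        (slotForm v 0 ^ (l - k) * slotForm w 0 ^ k * slotForm w 1 ^ (m - k)
        * slotForm v 1 ^ k) := by
    rw [sub_eq_neg_add, add_pow, Finset.mul_sum]
    refine Finset.sum_congr rfl fun k hk => ?_
    have hk' : k ≤ m := by simpa [Nat.lt_succ_iff] using hk
    rw [show l - k = (l - m) + (m - k) by omega, pow_add, smul_eq_C_mul, neg_pow]
    simp only [map_mul, map_pow, map_neg, map_one, map_natCast, mul_pow]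
    ring
  rw [e, map_sum, LinearMap.sum_apply] at h
  have h2 : ∀ k ∈ Finset.range (m + 1), apolar (((-1) ^ k * (m.choose k : K)) •
        (slotForm v 0 ^ (l - k) * slotForm w 0 ^ k * slotForm w 1 ^ (m - k)
        * slotForm v 1 ^ k)) f = (((m.choose k : ℚ) / l.choose k : ℚ) : K) *
          apolar (slotForm v 0 ^ l * slotForm w 1 ^ m) f := by
    intro k hk
    have hk' : k ≤ m := by simpa [Nat.lt_succ_iff] using hk
    have h3 := choose_mul_apolar_slotForm v w hf hml k hk'
    have h4 : (l.choose k : K) ≠ 0 := by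
      exact_mod_cast (Nat.choose_pos (hk'.trans hml)).ne'
    rw [map_smul, LinearMap.smul_apply, smul_eq_mul]
    push_cast
    rw [div_mul_eq_mul_div, eq_div_iff h4]
    have h5 : ((-1 : K) ^ k) * (-1) ^ k = 1 := by
      rw [← mul_pow]
      simp
    linear_combination ((-1) ^ k * (m.choose k : K)) * h3
      + (m.choose k : K) * apolar (slotForm v 0 ^ l * slotForm w 1 ^ m) f * h5
  rw [Finset.sum_congr rfl h2, ← Finset.sum_mul, ← Rat.cast_sum, mul_eq_zero] at h
  rcases h with h | h
  · rw [Rat.cast_eq_zero] at h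
    have : 0 < ∑ k ∈ Finset.range (m + 1), ((m.choose k : ℚ) / l.choose k : ℚ) := by
      refine Finset.sum_pos (fun k hk => ?_) ⟨0, by simp⟩
      have hk' : k ≤ m := by simpa [Nat.lt_succ_iff] using hk
      have h4 := Nat.choose_pos (hk'.trans hml)
      have h5 := Nat.choose_pos hk'
      positivity
    exact absurd h this.ne'
  · have h6 := apolar_linForm Prod.snd (slotPoint v w) f l m h₀ h₁
    rw [linForm_slotPoint, linForm_slotPoint, apolar_comm] at h6
    simp only [Matrix.cons_val_zero, Matrix.cons_val_one] at h6
    rw [h, eq_comm, mul_eq_zero, mul_eq_zero] at h6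
    rcases h6 with (h6 | h6) | h6
    · exact absurd (by exact_mod_cast h6) (Nat.factorial_ne_zero l)
    · exact absurd (by exact_mod_cast h6) (Nat.factorial_ne_zero m)
    · simpa using h6

end Slots

/-! ### The symplectic form and its Laplacian -/

section Laplacian

variable (K : Type*) [Field K]

/-- The symplectic form evaluated at the pair of generic vectors. -/
def symplForm : MvPolynomial ((Fin 2 ⊕ Fin 2) × Fin 2) K :=
  ∑ i, (X (.inl i, 0) * X (.inr i, 1) - X (.inr i, 0) * X (.inl i, 1))

/-- The constant coefficient operator that is adjoint to multiplication by `symplForm`. -/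
def symplLaplacian : MvPolynomial ((Fin 2 ⊕ Fin 2) × Fin 2) K →ₗ[K]
    MvPolynomial ((Fin 2 ⊕ Fin 2) × Fin 2) K :=
  ∑ i, ((pderiv (.inl i, 0)).toLinearMap ∘ₗ (pderiv (.inr i, 1)).toLinearMap
    - (pderiv (.inr i, 0)).toLinearMap ∘ₗ (pderiv (.inl i, 1)).toLinearMap)

variable {K}

lemma symplLaplacian_apply (f : MvPolynomial ((Fin 2 ⊕ Fin 2) × Fin 2) K) :
    symplLaplacian K f = ∑ i, (pderiv (.inl i, 0) (pderiv (.inr i, 1) f)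
      - pderiv (.inr i, 0) (pderiv (.inl i, 1) f)) := by
  simp [symplLaplacian]

lemma apolar_mul_symplForm (p f : MvPolynomial ((Fin 2 ⊕ Fin 2) × Fin 2) K) :
    apolar (p * symplForm K) f = apolar p (symplLaplacian K f) := by
  simp only [symplForm, symplLaplacian_apply, Finset.mul_sum, mul_sub, ← mul_assoc, map_sum,
    map_sub, LinearMap.sum_apply, LinearMap.sub_apply, apolar_mul_X]

lemma linSubst_kronecker_X (g : Matrix (Fin 2 ⊕ Fin 2) (Fin 2 ⊕ Fin 2) K) (j k) :
    linSubst K (g ⊗ₖ (1 : Matrix (Fin 2) (Fin 2) K)) (X (j, k)) = ∑ i, g i j • X (i, k) := by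
  rw [linSubst_X, Fintype.sum_prod_type]
  refine Finset.sum_congr rfl fun i _ => ?_
  rw [Finset.sum_eq_single k]
  · simp
  · intro k' _ hk
    simp [hk]
  · simp

lemma symplForm_eq : symplForm K = - ∑ i, ∑ j, Matrix.J (Fin 2) K i j •
    (X (i, 0) * X (j, 1)) := by
  simp [symplForm, Matrix.J, Matrix.one_apply]
  ring

lemma linSubst_symplForm {g : Matrix (Fin 2 ⊕ Fin 2) (Fin 2 ⊕ Fin 2) K}
    (hg : g ∈ Matrix.symplecticGroup (Fin 2) K) :
    linSubst K (g ⊗ₖ (1 : Matrix (Fin 2) (Fin 2) K)) (symplForm K) = symplForm K := by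
  have hg' := SymplecticGroup.mem_iff.1 hg
  rw [symplForm_eq, map_neg, map_sum]
  simp only [map_sum, map_smul, map_mul, linSubst_kronecker_X, Finset.sum_mul_sum, smul_mul_smul_comm,
    Finset.smul_sum, smul_smul]
  congr 1
  conv_rhs => rw [← hg']
  simp only [Matrix.mul_apply, Matrix.transpose_apply, Finset.sum_mul, Finset.sum_smul]
  have e1 : ∀ F : (Fin 2 ⊕ Fin 2) → (Fin 2 ⊕ Fin 2) → (Fin 2 ⊕ Fin 2) → (Fin 2 ⊕ Fin 2) →
      MvPolynomial ((Fin 2 ⊕ Fin 2) × Fin 2) K,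
      ∑ x, ∑ y, ∑ i, ∑ j, F x y i j = ∑ i, ∑ j, ∑ y, ∑ x, F x y i j := by
    intro F
    calc _ = ∑ x, ∑ i, ∑ y, ∑ j, F x y i j :=
          Finset.sum_congr rfl fun x _ => Finset.sum_comm
      _ = ∑ i, ∑ x, ∑ y, ∑ j, F x y i j := Finset.sum_comm
      _ = ∑ i, ∑ x, ∑ j, ∑ y, F x y i j :=
          Finset.sum_congr rfl fun i _ => Finset.sum_congr rfl fun x _ => Finset.sum_comm
      _ = ∑ i, ∑ j, ∑ x, ∑ y, F x y i j :=
          Finset.sum_congr rfl fun i _ => Finset.sum_comm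
      _ = _ := Finset.sum_congr rfl fun i _ => Finset.sum_congr rfl fun j _ => Finset.sum_comm
  rw [e1]
  refine Finset.sum_congr rfl fun i _ => Finset.sum_congr rfl fun j _ =>
    Finset.sum_congr rfl fun y _ => Finset.sum_congr rfl fun x _ => ?_
  congr 1
  ring

/-- Together with `symplLaplacian_euler` this is an sl₂ relation between ω, Δ and the Euler operator
E. The constant 4 counts the products of variables in ω. -/
lemma symplLaplacian_symplForm_mul (f : MvPolynomial ((Fin 2 ⊕ Fin 2) × Fin 2) K) :
    symplLaplacian K (symplForm K * f) = symplForm K * symplLaplacian K f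
      + ∑ j, X j * pderiv j f + 4 * f := by
  simp only [symplLaplacian_apply, symplForm, Fintype.sum_prod_type, Fintype.sum_sum_type,
    Fin.sum_univ_two, pderiv_mul, map_add, map_sub, pderiv_X, Pi.single_apply]
  simp
  ring

lemma coeff_euler {σ : Type*} [Fintype σ] (f : MvPolynomial σ K) (κ : σ →₀ ℕ) :
    coeff κ (∑ j, X j * pderiv j f) = κ.degree * coeff κ f := by
  classical
  induction f using MvPolynomial.induction_on' with
  | add p q hp hq => simp only [map_add, mul_add, Finset.sum_add_distrib, coeff_add, hp, hq]
  | monomial κ' r =>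
    simp only [X_mul_pderiv_monomial, ← Finset.sum_smul]
    rw [coeff_smul, coeff_monomial, Finsupp.degree_eq_sum]
    split_ifs with h
    · subst h
      simp
    · simp

lemma symplLaplacian_euler (f : MvPolynomial ((Fin 2 ⊕ Fin 2) × Fin 2) K) :
    symplLaplacian K (∑ j, X j * pderiv j f)
      = ∑ j, X j * pderiv j (symplLaplacian K f) + 2 * symplLaplacian K f := by
  have h : ∀ a b, a ≠ b → ∀ κ, coeff κ (pderiv a (pderiv b (∑ j, X j * pderiv j f)))
      = (κ.degree + 2) * coeff κ (pderiv a (pderiv b f)) := by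
    intro a b hab κ
    simp only [coeff_pderiv, coeff_euler, map_add, Finsupp.degree_single]
    push_cast
    ring
  ext κ
  rw [coeff_add, coeff_euler,
    show (2 : MvPolynomial ((Fin 2 ⊕ Fin 2) × Fin 2) K) = C 2 from rfl, coeff_C_mul,
    symplLaplacian_apply, symplLaplacian_apply, coeff_sum, coeff_sum]
  simp only [coeff_sub]
  rw [Finset.mul_sum, Finset.mul_sum, ← Finset.sum_add_distrib]
  refine Finset.sum_congr rfl fun i _ => ?_
  rw [h _ _ (by simp), h _ _ (by simp)]
  ring

/-- Applying Δ turns the equation (ωΔ + kE + c + 1) f = 0 into one of the same shape for Δf, which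
has smaller degree. Once Δf = 0, the operator multiplies each monomial by the nonzero scalar k·deg +
c + 1. -/
lemma eq_zero_of_symplForm_mul_symplLaplacian [CharZero K] (N : ℕ) :
    ∀ (f : MvPolynomial ((Fin 2 ⊕ Fin 2) × Fin 2) K) (k c : ℕ),
      (∀ κ : (Fin 2 ⊕ Fin 2) × Fin 2 →₀ ℕ, N ≤ κ.degree → coeff κ f = 0) →
      symplForm K * symplLaplacian K f + (k : MvPolynomial _ K) * ∑ j, X j * pderiv j f
        + ((c + 1 : ℕ) : MvPolynomial _ K) * f = 0 → f = 0 := by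
  induction N with
  | zero =>
    intro f k c hf _
    ext κ
    simpa using hf κ (Nat.zero_le _)
  | succ N ih =>
    intro f k c hf h
    have hg : symplLaplacian K f = 0 := by
      -- Commuting Δ past ω contributes E + 4, and past kE contributes 2k; the constant term is thus
      -- (2k + c + 4) + 1.
      refine ih _ (k + 1) (2 * k + c + 4) ?_ ?_
      · intro κ hκ
        rw [symplLaplacian_apply, coeff_sum]
        refine Finset.sum_eq_zero fun i _ => ?_
        simp only [coeff_sub, coeff_pderiv]
        rw [hf _ (by simp [map_add]; omega), hf _ (by simp [map_add]; omega)]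
        simp
      · have h2 := congrArg (symplLaplacian K) h
        rw [map_add, map_add, symplLaplacian_symplForm_mul, map_zero, ← nsmul_eq_mul, map_nsmul,
          symplLaplacian_euler, ← nsmul_eq_mul, map_nsmul, nsmul_eq_mul, nsmul_eq_mul] at h2
        rw [← h2]
        push_cast
        ring
    rw [hg, mul_zero, zero_add] at h
    ext κ
    have h3 := congrArg (coeff κ) h
    rw [coeff_add, ← nsmul_eq_mul, ← nsmul_eq_mul, coeff_smul, coeff_smul, coeff_euler,
      coeff_zero, nsmul_eq_mul, nsmul_eq_mul, ← mul_assoc, ← add_mul, mul_eq_zero] at h3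
    rcases h3 with h3 | h3
    · exfalso
      have : k * κ.degree + (c + 1) = 0 := by exact_mod_cast h3
      omega
    · simpa using h3

/-- For f = ωg the commutation relation turns Δf = 0 into (ωΔ + E + 4) g = 0, the case k = 1, c = 3
of the preceding lemma. -/
lemma eq_zero_of_mem_span_symplForm [CharZero K] {f : MvPolynomial ((Fin 2 ⊕ Fin 2) × Fin 2) K}
    (h : f ∈ Ideal.span {symplForm K}) (hf : symplLaplacian K f = 0) : f = 0 := by
  obtain ⟨g, rfl⟩ := Ideal.mem_span_singleton.1 h
  rw [symplLaplacian_symplForm_mul] at hf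
  have : g = 0 := by
    refine eq_zero_of_symplForm_mul_symplLaplacian (g.totalDegree + 1) g 1 3 ?_ ?_
    · intro κ hκ
      exact coeff_eq_zero_of_totalDegree_lt (by rw [← Finsupp.degree_apply]; omega)
    · rw [← hf]
      push_cast
      ring
  rw [this, mul_zero]

lemma symWW_apply (g : Sp4 K) (f : MvPolynomial ((Fin 2 ⊕ Fin 2) × Fin 2) K) :
    symWW K g f = linSubst K (g.1 ⊗ₖ (1 : Matrix (Fin 2) (Fin 2) K)) f :=
  symRep_eq_linSubst _ _

/-- Δ is adjoint to multiplication by ω, and the adjoint of g is the substitution by its transpose,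
which is again symplectic and so fixes ω. -/
lemma symplLaplacian_symWW [CharZero K] (g : Sp4 K)
    {f : MvPolynomial ((Fin 2 ⊕ Fin 2) × Fin 2) K}
    (hf : symplLaplacian K f = 0) : symplLaplacian K (symWW K g f) = 0 := by
  refine eq_zero_of_apolar fun p => ?_
  rw [← apolar_mul_symplForm, apolar_comm, symWW_apply, apolar_linSubst,
    ← Matrix.kroneckerMap_transpose, Matrix.transpose_one, map_mul,
    linSubst_symplForm (SymplecticGroup.transpose_mem g.2), apolar_comm, apolar_mul_symplForm,
    hf, map_zero]

lemma symplLaplacian_highestVector (l m : ℕ) :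
    symplLaplacian K (highestVector K l m) = 0 := by
  have h : ∀ i k, pderiv (.inr i, k) (highestVector K l m) = 0 := by
    intro i k
    simp [highestVector]
  -- Each term of Δ contains a derivative along some f-variable, and the highest weight vector
  -- involves none. When that derivative is the outer one, a comparison of coefficients is needed.
  have h' : ∀ i k j k', pderiv (.inr i, k) (pderiv (.inl j, k') (highestVector K l m)) = 0 := by
    intro i k j k'
    have hh := h i k
    ext κ
    have h2 := congrArg (coeff (κ + Finsupp.single (.inl j, k') 1)) hh
    rw [coeff_pderiv] at h2
    simp only [coeff_pderiv]
    rw [add_right_comm]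
    simp at h2 ⊢
    rcases h2 with h2 | h2
    · simp [h2]
    · simp [h2]
  rw [symplLaplacian_apply]
  simp [h, h']

lemma symplLaplacian_of_mem_WSpace [CharZero K] {l m : ℕ}
    {f : MvPolynomial ((Fin 2 ⊕ Fin 2) × Fin 2) K} (hf : f ∈ WSpace K l m) :
    symplLaplacian K f = 0 := by
  have : WSpace K l m ≤ LinearMap.ker (symplLaplacian K) := by
    refine Submodule.span_le.2 ?_
    rintro _ ⟨g, rfl⟩
    exact symplLaplacian_symWW g (symplLaplacian_highestVector l m)
  exact this hf

end Laplacian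

/-! ### The generating forms of the summands -/

section GenForm

/-- The index of the plane `⟨eₖ, fₖ⟩` that contains a basis vector. -/
def planeOf : Fin 2 ⊕ Fin 2 → Fin 2 := Sum.elim id id

variable {K Q : Type*} [Field K] [CommRing Q] [Algebra K Q]

/-- The contribution of the plane `⟨eₖ, fₖ⟩` to the value of the symplectic form. -/
def planeMinor (z w : Fin 2 ⊕ Fin 2 → Q) (k : Fin 2) : Q :=
  z (.inl k) * w (.inr k) - z (.inr k) * w (.inl k)

/-- The `2 × 2` minor of the components of `z`, `w` in the two planes, evaluated at a pair of
linear forms. -/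
def pairForm (z w : Fin 2 ⊕ Fin 2 → Q) : MvPolynomial (Fin 2 ⊕ Fin 2) Q :=
  linForm planeOf z 0 * linForm planeOf w 1 - linForm planeOf w 0 * linForm planeOf z 1

/-- The form whose coefficients span the image of `V_{α+i} ⊗ V_{β+i}`. -/
def genForm (z w : Fin 2 ⊕ Fin 2 → Q) (a b i : ℕ) : MvPolynomial (Fin 2 ⊕ Fin 2) Q :=
  linForm planeOf z 0 ^ a * linForm planeOf z 1 ^ b * pairForm z w ^ i

/-- Up to sign, the variable of the symplectic partner of a basis vector. -/
def partner : Fin 2 ⊕ Fin 2 → MvPolynomial (Fin 2 ⊕ Fin 2) Q :=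
  Sum.elim (fun k => X (.inr k)) (fun k => - X (.inl k))

lemma linForm_planeOf (v : Fin 2 ⊕ Fin 2 → Q) (k : Fin 2) :
    linForm planeOf v k = C (v (.inl k)) * X (.inl k) + C (v (.inr k)) * X (.inr k) := by
  fin_cases k <;> simp [linForm, planeOf]

lemma planeOf_cases (j : Fin 2 ⊕ Fin 2) : planeOf j = 0 ∨ planeOf j = 1 := by
  revert j
  decide

lemma pderiv_pairForm (z w : Fin 2 ⊕ Fin 2 → Q) (j : Fin 2 ⊕ Fin 2) :
    pderiv j (pairForm z w) = if planeOf j = 0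
      then C (z j) * linForm planeOf w 1 - C (w j) * linForm planeOf z 1
      else C (w j) * linForm planeOf z 0 - C (z j) * linForm planeOf w 0 := by
  rw [pairForm, map_sub, pderiv_mul, pderiv_mul]
  simp only [pderiv_linForm]
  rcases planeOf_cases j with h | h
  · simp [h]
  · simp [h]
    ring

variable {z w : Fin 2 ⊕ Fin 2 → Q}

/-- This and the next relations trade derivatives of M for coordinates or minors, at the cost of s
times a variable. They make the derivatives of generating forms expressible through generating forms
again; those that involve the second plane's contribution use isotropy. -/
lemma linForm_mul_pderiv_pairForm₀ {j : Fin 2 ⊕ Fin 2} (hj : planeOf j = 0) :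
    linForm planeOf z 0 * pderiv j (pairForm z w) = C (z j) * pairForm z w
      + C (planeMinor z w 0) * partner j * linForm planeOf z 1 := by
  rw [pderiv_pairForm, if_pos hj, pairForm, planeMinor]
  rcases j with j | j <;> obtain rfl : j = 0 := hj <;>
  · simp only [linForm_planeOf, partner, Sum.elim_inl, Sum.elim_inr, map_sub, map_mul]
    ring

lemma planeMinor_one (h : planeMinor z w 0 + planeMinor z w 1 = 0) :
    planeMinor z w 0 = - planeMinor z w 1 := eq_neg_of_add_eq_zero_left h

lemma linForm_mul_pderiv_pairForm₁ (h : planeMinor z w 0 + planeMinor z w 1 = 0)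
    {j : Fin 2 ⊕ Fin 2} (hj : planeOf j = 1) :
    linForm planeOf z 1 * pderiv j (pairForm z w) = C (z j) * pairForm z w
      + C (planeMinor z w 0) * partner j * linForm planeOf z 0 := by
  rw [pderiv_pairForm, if_neg (by simp [hj]), pairForm, planeMinor_one h, planeMinor]
  rcases j with j | j <;> obtain rfl : j = 1 := hj <;>
  · simp only [linForm_planeOf, partner, Sum.elim_inl, Sum.elim_inr, map_sub, map_mul, map_neg]
    ring

lemma C_mul_pderiv_pairForm {j k : Fin 2 ⊕ Fin 2} (hj : planeOf j = 0) (hk : planeOf k = 1) :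
    C (z j) * pderiv k (pairForm z w) = linForm planeOf z 0 * C (z j * w k - w j * z k)
      - C (planeMinor z w 0) * partner j * C (z k) := by
  rw [pderiv_pairForm, if_neg (by simp [hk]), planeMinor]
  rcases j with j | j <;> obtain rfl : j = 0 := hj <;>
  · simp only [linForm_planeOf, partner, Sum.elim_inl, Sum.elim_inr, map_sub, map_mul]
    ring

lemma pderiv_pairForm_mul (h : planeMinor z w 0 + planeMinor z w 1 = 0)
    {j k : Fin 2 ⊕ Fin 2} (hj : planeOf j = 0) (hk : planeOf k = 1) :
    pderiv j (pairForm z w) * pderiv k (pairForm z w)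
      = pairForm z w * C (z j * w k - w j * z k)
        + C (planeMinor z w 0) ^ 2 * partner j * partner k := by
  rw [pderiv_pairForm, if_pos hj, pderiv_pairForm, if_neg (by simp [hk]), pow_two]
  nth_rw 2 [planeMinor_one h]
  rw [planeMinor, planeMinor, pairForm]
  rcases j with j | j <;> obtain rfl : j = 0 := hj <;>
  rcases k with k | k <;> obtain rfl : k = 1 := hk <;>
  · simp only [linForm_planeOf, partner, Sum.elim_inl, Sum.elim_inr, map_sub, map_mul, map_neg]
    ring

lemma pderiv_pderiv_pairForm {j k : Fin 2 ⊕ Fin 2} (hj : planeOf j = 0) (hk : planeOf k = 1) :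
    pderiv j (pderiv k (pairForm z w)) = C (z j * w k - w j * z k) := by
  rw [pderiv_pairForm, if_neg (by simp [hk]), map_sub, pderiv_C_mul, pderiv_C_mul,
    pderiv_linForm, pderiv_linForm, if_pos hj, if_pos hj]
  simp
  ring

variable (K) in
/-- The span of the coefficients of the forms `s^(m-i) G_{a,b,i}` with `a + b = n`. -/
def genSpan (z w : Fin 2 ⊕ Fin 2 → Q) (n m : ℕ) : Submodule K Q :=
  Submodule.span K {x | ∃ a b i κ, a + b = n ∧ i ≤ m ∧
    x = planeMinor z w 0 ^ (m - i) * coeff κ (genForm z w a b i)}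

lemma C_mul_genForm_mem {n m a b i : ℕ} (hab : a + b = n) (hi : i ≤ m) :
    C (planeMinor z w 0 ^ (m - i)) * genForm z w a b i
      ∈ coeffsIn (Fin 2 ⊕ Fin 2) (genSpan K z w n m) := by
  intro κ
  rw [coeff_C_mul]
  exact Submodule.subset_span ⟨a, b, i, κ, hab, hi, rfl⟩

lemma genSpan_le {n m : ℕ} {S : Submodule K Q}
    (h : ∀ a b i, a + b = n → i ≤ m → C (planeMinor z w 0 ^ (m - i)) * genForm z w a b i
      ∈ coeffsIn (Fin 2 ⊕ Fin 2) S) : genSpan K z w n m ≤ S := by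
  refine Submodule.span_le.2 ?_
  rintro _ ⟨a, b, i, κ, hab, hi, rfl⟩
  rw [← coeff_C_mul]
  exact h a b i hab hi κ

lemma pderiv_mem_coeffsIn {σ : Type*} {S : Submodule K Q} {F : MvPolynomial σ Q}
    (hF : F ∈ coeffsIn σ S) (j : σ) : pderiv j F ∈ coeffsIn σ S := by
  intro κ
  rw [coeff_pderiv]
  have := S.nsmul_mem (hF (κ + Finsupp.single j 1)) (κ j + 1)
  rw [nsmul_eq_mul] at this
  push_cast at this
  rwa [mul_comm]

lemma partner_mul_mem {S : Submodule K Q} {F : MvPolynomial (Fin 2 ⊕ Fin 2) Q}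
    (hF : F ∈ coeffsIn (Fin 2 ⊕ Fin 2) S) (j : Fin 2 ⊕ Fin 2) :
    partner j * F ∈ coeffsIn (Fin 2 ⊕ Fin 2) S := by
  rcases j with j | j
  · simpa [partner] using hF
  · simpa [partner] using hF

lemma mem_of_natCast_mul_mem [CharZero K] {σ : Type*} {S : Submodule K Q} {F : MvPolynomial σ Q}
    (n : ℕ) (h : ((n + 1 : ℕ) : MvPolynomial σ Q) * F ∈ coeffsIn σ S) : F ∈ coeffsIn σ S := by
  have h2 := (coeffsIn σ S).smul_mem ((n + 1 : ℕ) : K)⁻¹ h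
  rw [← nsmul_eq_mul, ← Nat.cast_smul_eq_nsmul K, smul_smul, inv_mul_cancel₀, one_smul] at h2
  · exact h2
  · exact_mod_cast Nat.succ_ne_zero n

lemma natCast_mul_mem {σ : Type*} {S : Submodule K Q} {F : MvPolynomial σ Q}
    (n : ℕ) (h : F ∈ coeffsIn σ S) : (n : MvPolynomial σ Q) * F ∈ coeffsIn σ S := by
  rw [← nsmul_eq_mul]
  exact (coeffsIn σ S).nsmul_mem h n

/-- Multiplication by `x` as a condition on the coefficients of generating forms. -/
lemma mul_mem_of_genForm {n m : ℕ} {S : Submodule K Q} (x : Q)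
    (h : ∀ a b i, a + b = n → i ≤ m → C x * (C (planeMinor z w 0 ^ (m - i)) * genForm z w a b i)
      ∈ coeffsIn (Fin 2 ⊕ Fin 2) S) {y : Q} (hy : y ∈ genSpan K z w n m) : x * y ∈ S := by
  have : genSpan K z w n m ≤ S.comap (LinearMap.mulLeft K x) := by
    refine genSpan_le fun a b i hab hi κ => ?_
    have := h a b i hab hi κ
    rwa [coeff_C_mul] at this
  exact this hy

lemma planeMinor_mul_mem {n m : ℕ} {y : Q} (hy : y ∈ genSpan K z w n m) :
    planeMinor z w 0 * y ∈ genSpan K z w n (m + 1) := by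
  refine mul_mem_of_genForm _ (fun a b i hab hi => ?_) hy
  have := C_mul_genForm_mem (K := K) (z := z) (w := w) hab (show i ≤ m + 1 by omega)
  rwa [show m + 1 - i = m - i + 1 by omega, pow_succ', map_mul, mul_assoc] at this

lemma C_mul_mem_coeffsIn {n m n' m' : ℕ} {x : Q}
    (hx : ∀ y ∈ genSpan K z w n m, x * y ∈ genSpan K z w n' m')
    {F : MvPolynomial (Fin 2 ⊕ Fin 2) Q}
    (hF : F ∈ coeffsIn (Fin 2 ⊕ Fin 2) (genSpan K z w n m)) :
    C x * F ∈ coeffsIn (Fin 2 ⊕ Fin 2) (genSpan K z w n' m') := by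
  intro κ
  rw [coeff_C_mul]
  exact hx _ (hF κ)

variable [CharZero K]

/-- For j in the first plane, ∂_j (X^(a+1) Y^b M^i) = (a + 1 + i) z_j X^a Y^b M^i + i s π X^a
Y^(b+1) M^(i-1), where π is `partner j`. Derivatives and multiples by variables keep coefficients in
the span, and the integer factor is invertible. The second plane is symmetric. -/
lemma coord_mul_mem (h : planeMinor z w 0 + planeMinor z w 1 = 0) {n m : ℕ}
    (j : Fin 2 ⊕ Fin 2) {y : Q} (hy : y ∈ genSpan K z w n m) :
    z j * y ∈ genSpan K z w (n + 1) m := by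
  refine mul_mem_of_genForm _ (fun a b i hab hi => ?_) hy
  rcases planeOf_cases j with hj | hj
  · refine mem_of_natCast_mul_mem (a + i) ?_
    have h1 := pderiv_mem_coeffsIn (C_mul_genForm_mem (K := K) (z := z) (w := w)
      (show a + 1 + b = n + 1 by omega) hi) j
    rw [pderiv_C_mul] at h1
    have hk := linForm_mul_pderiv_pairForm₀ (z := z) (w := w) hj
    rcases i with _ | i
    · convert h1 using 1
      simp only [genForm, pderiv_mul, pderiv_pow, pderiv_linForm, hj]
      simp
      ring
    · have h2 := natCast_mul_mem (i + 1) (partner_mul_mem (C_mul_genForm_mem (K := K) (z := z)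
        (w := w) (show a + (b + 1) = n + 1 by omega) (show i ≤ m by omega)) j)
      convert Submodule.sub_mem _ h1 h2 using 1
      rw [show m - i = m - (i + 1) + 1 by omega, pow_succ]
      simp only [genForm, pderiv_mul, pderiv_pow, pderiv_linForm, hj, if_true, zero_ne_one,
        if_false, Nat.add_sub_cancel, map_mul, mul_zero]
      push_cast
      linear_combination (- C (planeMinor z w 0 ^ (m - (i + 1))) * (i + 1) *
        linForm planeOf z 0 ^ a * linForm planeOf z 1 ^ b * pairForm z w ^ i) * hk
  · refine mem_of_natCast_mul_mem (b + i) ?_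
    have h1 := pderiv_mem_coeffsIn (C_mul_genForm_mem (K := K) (z := z) (w := w)
      (show a + (b + 1) = n + 1 by omega) hi) j
    rw [pderiv_C_mul] at h1
    have hk := linForm_mul_pderiv_pairForm₁ h hj
    rcases i with _ | i
    · convert h1 using 1
      simp only [genForm, pderiv_mul, pderiv_pow, pderiv_linForm, hj]
      simp
      ring
    · have h2 := natCast_mul_mem (i + 1) (partner_mul_mem (C_mul_genForm_mem (K := K) (z := z)
        (w := w) (show a + 1 + b = n + 1 by omega) (show i ≤ m by omega)) j)
      convert Submodule.sub_mem _ h1 h2 using 1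
      rw [show m - i = m - (i + 1) + 1 by omega, pow_succ]
      simp only [genForm, pderiv_mul, pderiv_pow, pderiv_linForm, hj, if_true, one_ne_zero,
        if_false, Nat.add_sub_cancel, map_mul, mul_zero]
      push_cast
      linear_combination (- C (planeMinor z w 0 ^ (m - (i + 1))) * (i + 1) *
        linForm planeOf z 0 ^ a * linForm planeOf z 1 ^ b * pairForm z w ^ i) * hk

/-- Solve ∂_k (X^a Y^b M^(i+1)) for X^a Y^b M^i ∂_k M, replacing z_k M by Y ∂_k M - s π X with π the
partner of k. The factor is b + i + 1, and the correction is a multiple of s X^(a+1) Y^(b-1) M^i. -/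
lemma genForm_mul_pderiv_mem (h : planeMinor z w 0 + planeMinor z w 1 = 0) {n m a b i : ℕ}
    (hab : a + b = n) (hi : i ≤ m) {k : Fin 2 ⊕ Fin 2} (hk : planeOf k = 1) :
    C (planeMinor z w 0 ^ (m - i)) * genForm z w a b i * pderiv k (pairForm z w)
      ∈ coeffsIn (Fin 2 ⊕ Fin 2) (genSpan K z w n (m + 1)) := by
  refine mem_of_natCast_mul_mem (b + i) ?_
  have h1 := pderiv_mem_coeffsIn (C_mul_genForm_mem (K := K) (z := z) (w := w)
      hab (show i + 1 ≤ m + 1 by omega)) k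
  rw [pderiv_C_mul, Nat.add_sub_add_right] at h1
  rcases b with _ | b
  · convert h1 using 1
    simp only [genForm, pderiv_mul, pderiv_pow, pderiv_linForm, hk]
    simp
    ring
  · have h2 := natCast_mul_mem (b + 1) (partner_mul_mem (C_mul_genForm_mem (K := K) (z := z)
        (w := w) (show a + 1 + b = n by omega) (show i ≤ m + 1 by omega)) k)
    have hk' := linForm_mul_pderiv_pairForm₁ h hk
    convert Submodule.add_mem _ h1 h2 using 1
    rw [show m + 1 - i = m - i + 1 by omega, pow_succ]
    simp only [genForm, pderiv_mul, pderiv_pow, pderiv_linForm, hk, if_true, one_ne_zero,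
        if_false, Nat.add_sub_cancel, map_mul, mul_zero]
    push_cast
    linear_combination (C (planeMinor z w 0 ^ (m - i)) * (b + 1) *
        linForm planeOf z 0 ^ a * linForm planeOf z 1 ^ b * pairForm z w ^ i) * hk'

/-- The minor is ∂_j ∂_k M. Differentiating X^a Y^b M^i ∂_k M in the j-th variable gives (a + i + 1)
times the desired product, up to the corrections `hA` and `hB`, which lie in the span by
`coord_mul_mem` and by lowering i. -/
lemma mixed_minor_mul_mem (h : planeMinor z w 0 + planeMinor z w 1 = 0) {n m : ℕ}
    {j k : Fin 2 ⊕ Fin 2} (hj : planeOf j = 0) (hk : planeOf k = 1)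
    {y : Q} (hy : y ∈ genSpan K z w n m) :
    (z j * w k - w j * z k) * y ∈ genSpan K z w n (m + 1) := by
  refine mul_mem_of_genForm _ (fun a b i hab hi => ?_) hy
  refine mem_of_natCast_mul_mem (a + i) ?_
  have h1 := pderiv_mem_coeffsIn (genForm_mul_pderiv_mem (K := K) h hab hi hk) j
  have hA : (a : MvPolynomial (Fin 2 ⊕ Fin 2) Q) * (partner j * (C (z k) *
      (C (planeMinor z w 0 ^ (m + 1 - i)) * genForm z w (a - 1) b i)))
      ∈ coeffsIn (Fin 2 ⊕ Fin 2) (genSpan K z w n (m + 1)) := by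
    rcases a with _ | a
    · simp
    · refine natCast_mul_mem _ (partner_mul_mem ?_ j)
      have := C_mul_mem_coeffsIn (fun y hy => coord_mul_mem (K := K) h k hy)
        (C_mul_genForm_mem (K := K) (z := z) (w := w) (show a + b = a + b from rfl)
          (show i ≤ m + 1 by omega))
      rwa [show a + b + 1 = n by omega] at this
  have hB : (i : MvPolynomial (Fin 2 ⊕ Fin 2) Q) * (partner j * (partner k *
      (C (planeMinor z w 0 ^ (m + 1 - (i - 1))) * genForm z w a b (i - 1))))
      ∈ coeffsIn (Fin 2 ⊕ Fin 2) (genSpan K z w n (m + 1)) :=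
    natCast_mul_mem _ (partner_mul_mem (partner_mul_mem
      (C_mul_genForm_mem hab (by omega)) k) j)
  convert Submodule.sub_mem _ (Submodule.add_mem _ h1 hA) hB using 1
  have e1 := C_mul_pderiv_pairForm (z := z) (w := w) hj hk
  have e2 := pderiv_pairForm_mul h hj hk
  rw [pderiv_mul, pderiv_C_mul, pderiv_pderiv_pairForm hj hk,
    show m + 1 - i = m - i + 1 by omega]
  simp only [genForm, pderiv_mul, pderiv_pow, pderiv_linForm, hj, if_true, zero_ne_one,
        if_false, map_pow, mul_zero, add_zero]
  have e3 : (a : MvPolynomial (Fin 2 ⊕ Fin 2) Q) * linForm planeOf z 0 ^ (a - 1)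
      * linForm planeOf z 0 = a * linForm planeOf z 0 ^ a := by
    rcases a with _ | a
    · simp
    · simp [pow_succ, mul_assoc]
  have e4 : (i : MvPolynomial (Fin 2 ⊕ Fin 2) Q) * pairForm z w ^ (i - 1)
      * pairForm z w = i * pairForm z w ^ i := by
    rcases i with _ | i
    · simp
    · simp [pow_succ, mul_assoc]
  -- The factor i makes the truncated i - 1 harmless at i = 0.
  have e5 : (i : MvPolynomial (Fin 2 ⊕ Fin 2) Q) * C (planeMinor z w 0) ^ (m + 1 - (i - 1))
      = (i : MvPolynomial (Fin 2 ⊕ Fin 2) Q) * C (planeMinor z w 0) ^ (m - i)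
          * C (planeMinor z w 0) ^ 2 := by
    rcases i with _ | i
    · simp
    · rw [Nat.add_sub_cancel, show m + 1 - i = m - (i + 1) + 2 by omega, pow_add, mul_assoc]
  set X' := linForm planeOf z 0
  set Y' := linForm planeOf z 1
  set M' := pairForm z w
  set S' := (C (planeMinor z w 0) : MvPolynomial (Fin 2 ⊕ Fin 2) Q)
  push_cast
  linear_combination (- S' ^ (m - i) * a * X' ^ (a - 1) * Y' ^ b * M' ^ i) * e1
    - (S' ^ (m - i) * i * X' ^ a * Y' ^ b * M' ^ (i - 1)) * e2
    - (S' ^ (m - i) * Y' ^ b * M' ^ i * C (z j * w k - w j * z k)) * e3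
    - (S' ^ (m - i) * X' ^ a * Y' ^ b * C (z j * w k - w j * z k)) * e4
    + (partner j * partner k * X' ^ a * Y' ^ b * M' ^ (i - 1)) * e5

/-- A minor with both indices in one plane is 0 or, by isotropy, ±s; the others are mixed minors up
to sign. -/
lemma minor_mul_mem (h : planeMinor z w 0 + planeMinor z w 1 = 0) {n m : ℕ}
    (j k : Fin 2 ⊕ Fin 2) {y : Q} (hy : y ∈ genSpan K z w n m) :
    (z j * w k - w j * z k) * y ∈ genSpan K z w n (m + 1) := by
  have hs := planeMinor_mul_mem hy
  have hs' : planeMinor z w 1 * y ∈ genSpan K z w n (m + 1) := by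
    rw [eq_neg_of_add_eq_zero_right h, neg_mul]
    exact Submodule.neg_mem _ hs
  have hkk : ∀ k, planeMinor z w k * y ∈ genSpan K z w n (m + 1) := by
    intro k
    fin_cases k
    · exact hs
    · exact hs'
  have same : ∀ k, (z (.inl k) * w (.inr k) - w (.inl k) * z (.inr k)) * y
      ∈ genSpan K z w n (m + 1) := by
    intro k
    convert hkk k using 1
    rw [planeMinor]
    ring
  have hneg : ∀ j k, (z j * w k - w j * z k) * y ∈ genSpan K z w n (m + 1) →
      (z k * w j - w k * z j) * y ∈ genSpan K z w n (m + 1) := by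
    intro j k h
    convert Submodule.neg_mem _ h using 1
    ring
  have hself : ∀ j, (z j * w j - w j * z j) * y ∈ genSpan K z w n (m + 1) := by
    intro j
    rw [mul_comm (z j), sub_self, zero_mul]
    exact Submodule.zero_mem _
  rcases planeOf_cases j with hj | hj <;> rcases planeOf_cases k with hk | hk
  · rcases j with j | j <;> rcases k with k | k <;> obtain rfl : j = 0 := hj <;>
      obtain rfl : k = 0 := hk
    · exact hself _
    · exact same _
    · exact hneg _ _ (same _)
    · exact hself _
  · exact mixed_minor_mul_mem h hj hk hy
  · exact hneg _ _ (mixed_minor_mul_mem h hk hj hy)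
  · rcases j with j | j <;> rcases k with k | k <;> obtain rfl : j = 1 := hj <;>
      obtain rfl : k = 1 := hk
    · exact hself _
    · exact same _
    · exact hneg _ _ (same _)
    · exact hself _

/-- Products of linear forms and minors lie in the span of the coefficients of the generating
forms. -/
lemma pow_mul_pow_mem_genSpan (h : planeMinor z w 0 + planeMinor z w 1 = 0)
    (u v : Fin 2 ⊕ Fin 2 → K) (n m : ℕ) :
    (∑ j, u j • z j) ^ n * ((∑ j, u j • z j) * (∑ j, v j • w j)
      - (∑ j, v j • z j) * (∑ j, u j • w j)) ^ m ∈ genSpan K z w n m := by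
  have base : (1 : Q) ∈ genSpan K z w 0 0 := by
    refine Submodule.subset_span ⟨0, 0, 0, 0, rfl, le_rfl, ?_⟩
    simp [genForm]
  induction n with
  | zero =>
    rw [pow_zero, one_mul]
    induction m with
    | zero => simpa using base
    | succ m ih =>
      have e : (∑ j, u j • z j) * (∑ j, v j • w j) - (∑ j, v j • z j) * (∑ j, u j • w j)
          = ∑ j, ∑ k, (u j * v k) • (z j * w k - w j * z k) := by
        rw [mul_comm (∑ j, v j • z j), Finset.sum_mul_sum, Finset.sum_mul_sum,
          ← Finset.sum_sub_distrib]
        refine Finset.sum_congr rfl fun j _ => ?_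
        rw [← Finset.sum_sub_distrib]
        refine Finset.sum_congr rfl fun k _ => ?_
        rw [smul_mul_smul_comm, smul_mul_smul_comm, smul_sub]
      rw [pow_succ']
      nth_rw 1 [e]
      rw [Finset.sum_mul]
      refine Submodule.sum_mem _ fun j _ => ?_
      rw [Finset.sum_mul]
      refine Submodule.sum_mem _ fun k _ => ?_
      rw [smul_mul_assoc]
      exact Submodule.smul_mem _ _ (minor_mul_mem h j k ih)
  | succ n ih =>
    rw [pow_succ', mul_assoc, Finset.sum_mul]
    refine Submodule.sum_mem _ fun j _ => ?_
    rw [smul_mul_assoc]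
    exact Submodule.smul_mem _ _ (coord_mul_mem h j ih)

end GenForm

/-! ### The map assembled from the generating forms -/

section GenMap

variable {K Q : Type*} [Field K] [CommRing Q] [Algebra K Q]

/-- The sum of the generating forms `G_{a,b,i}` with `a + b = n`. -/
def sumForm (z w : Fin 2 ⊕ Fin 2 → Q) (n i : ℕ) : MvPolynomial (Fin 2 ⊕ Fin 2) Q :=
  ∑ b ∈ Finset.range (n + 1), genForm z w (n - b) b i

variable (K) in
/-- The polynomials on `K⁴` all of whose bidegrees with respect to the two planes are of the form
`(n - b + i, b + i)` with `b ≤ n`. -/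
def bidegSpace (n i : ℕ) : Submodule K (MvPolynomial (Fin 2 ⊕ Fin 2) K) :=
  restrictSupport K {κ | ∃ b ≤ n, Finsupp.weight (colorWeight planeOf 0) κ = n - b + i ∧
    Finsupp.weight (colorWeight planeOf 1) κ = b + i}

variable (K) in
/-- The apolar pairing with the generating forms. -/
def genMap (z w : Fin 2 ⊕ Fin 2 → Q) (n m : ℕ) :
    (Fin (m + 1) → MvPolynomial (Fin 2 ⊕ Fin 2) K) →ₗ[K] Q :=
  ∑ i : Fin (m + 1), LinearMap.mulLeft K (planeMinor z w 0 ^ (m - i)) ∘ₗ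
    apolar.flip (sumForm z w n i) ∘ₗ LinearMap.proj i

lemma genMap_apply (z w : Fin 2 ⊕ Fin 2 → Q) (n m : ℕ)
    (p : Fin (m + 1) → MvPolynomial (Fin 2 ⊕ Fin 2) K) :
    genMap K z w n m p
      = ∑ i : Fin (m + 1), planeMinor z w 0 ^ (m - i) * apolar (p i) (sumForm z w n i) := by
  simp [genMap]

/-! #### Functoriality -/

section Functoriality

variable {Q' : Type*} [CommRing Q'] [Algebra K Q'] (φ : Q →ₐ[K] Q')

lemma map_linForm (z : Fin 2 ⊕ Fin 2 → Q) (k : Fin 2) :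
    MvPolynomial.map φ.toRingHom (linForm planeOf z k) = linForm planeOf (φ ∘ z) k := by
  simp [linForm_planeOf]

lemma map_sumForm (z w : Fin 2 ⊕ Fin 2 → Q) (n i : ℕ) :
    MvPolynomial.map φ.toRingHom (sumForm z w n i) = sumForm (φ ∘ z) (φ ∘ w) n i := by
  simp only [sumForm, genForm, pairForm, map_sum, map_mul, map_pow, map_sub, map_linForm]

lemma map_genMap (z w : Fin 2 ⊕ Fin 2 → Q) (n m : ℕ)
    (p : Fin (m + 1) → MvPolynomial (Fin 2 ⊕ Fin 2) K) :
    φ (genMap K z w n m p) = genMap K (φ ∘ z) (φ ∘ w) n m p := by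
  simp only [genMap_apply, map_sum, map_mul, map_pow, map_apolar, map_sumForm]
  simp [planeMinor]

end Functoriality

/-! #### Equivariance -/

section Equivariance

/-- A matrix that permutes the planes by τ can be moved from the coordinates of z to the auxiliary
variables, as a transposed substitution. The apolar adjunction transposes it back, so that g itself
acts on the argument of `genMap`. -/
lemma linForm_transform {z z' : Fin 2 ⊕ Fin 2 → Q} {g : Matrix (Fin 2 ⊕ Fin 2) (Fin 2 ⊕ Fin 2) K}
    (hz : ∀ j, z' j = ∑ i, g i j • z i) (τ : Equiv.Perm (Fin 2))
    (hg : ∀ i j, planeOf i ≠ τ (planeOf j) → g i j = 0) (k : Fin 2) :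
    linForm planeOf z' k = linSubst Q g.transpose (linForm planeOf z (τ k)) := by
  have e1 : linForm planeOf z' k
      = ∑ j, ∑ i, if planeOf j = k then g i j • (C (z i) * X j) else 0 := by
    rw [linForm]
    refine Finset.sum_congr rfl fun j _ => ?_
    split_ifs with h
    · rw [hz, map_sum, Finset.sum_mul]
      refine Finset.sum_congr rfl fun i _ => ?_
      rw [Algebra.smul_def, Algebra.smul_def, map_mul, mul_assoc]
      rfl
    · simp
  have e2 : linSubst Q g.transpose (linForm planeOf z (τ k))
      = ∑ i, ∑ j, if planeOf i = τ k then g i j • (C (z i) * X j) else 0 := by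
    rw [linForm, map_sum]
    refine Finset.sum_congr rfl fun i _ => ?_
    split_ifs with h
    · rw [map_mul, linSubst_X, linSubst_C, Finset.mul_sum]
      simp
    · simp
  rw [e1, e2, Finset.sum_comm]
  refine Finset.sum_congr rfl fun i _ => Finset.sum_congr rfl fun j _ => ?_
  by_cases h : planeOf i = τ (planeOf j)
  · simp only [h, τ.apply_eq_iff_eq]
  · rw [hg i j h]
    simp

variable {z w z' w' : Fin 2 ⊕ Fin 2 → Q} {g : Matrix (Fin 2 ⊕ Fin 2) (Fin 2 ⊕ Fin 2) K}

lemma genMap_transform_one (hz : ∀ j, z' j = ∑ i, g i j • z i) (hw : ∀ j, w' j = ∑ i, g i j • w i)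
    (hg : ∀ i j, planeOf i ≠ planeOf j → g i j = 0)
    (hm : planeMinor z' w' 0 = planeMinor z w 0) (n m : ℕ)
    (p : Fin (m + 1) → MvPolynomial (Fin 2 ⊕ Fin 2) K) :
    genMap K z' w' n m p = genMap K z w n m fun i => linSubst K g (p i) := by
  have hs : ∀ i, sumForm z' w' n i = linSubst Q g.transpose (sumForm z w n i) := by
    intro i
    simp only [sumForm, genForm, pairForm, map_sum, map_mul, map_pow, map_sub,
      linForm_transform hz 1 hg, linForm_transform hw 1 hg, Equiv.Perm.one_apply]
  simp only [genMap_apply, hm, hs, apolar_linSubst]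

lemma genMap_transform_swap (h : planeMinor z w 0 + planeMinor z w 1 = 0)
    (hz : ∀ j, z' j = ∑ i, g i j • z i) (hw : ∀ j, w' j = ∑ i, g i j • w i)
    (hg : ∀ i j, planeOf i ≠ Equiv.swap 0 1 (planeOf j) → g i j = 0)
    (hm : planeMinor z' w' 0 = planeMinor z w 1) (n m : ℕ)
    (p : Fin (m + 1) → MvPolynomial (Fin 2 ⊕ Fin 2) K) :
    genMap K z' w' n m p = genMap K z w n m fun i => (-1 : K) ^ m • linSubst K g (p i) := by
  have hs : ∀ i, sumForm z' w' n i = C ((-1) ^ i) * linSubst Q g.transpose (sumForm z w n i) := by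
    intro i
    -- The exchange of the planes swaps the exponents n - b and b, so one of the sums is reversed.
    rw [sumForm, sumForm, map_sum, Finset.mul_sum, ← Finset.sum_range_reflect]
    refine Finset.sum_congr rfl fun b hb => ?_
    have hb' : b ≤ n := by simpa [Nat.lt_succ_iff] using hb
    have e : linSubst Q g.transpose (pairForm z w) = - pairForm z' w' := by
      simp only [pairForm, map_mul, map_sub, linForm_transform hz _ hg,
        linForm_transform hw _ hg, Equiv.swap_apply_left, Equiv.swap_apply_right]
      ring
    rw [show n + 1 - 1 - b = n - b by omega, show n - (n - b) = b by omega]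
    simp only [genForm, map_mul, map_pow, e, linForm_transform hz _ hg, Equiv.swap_apply_left,
      Equiv.swap_apply_right, map_neg, map_one]
    rw [neg_pow (pairForm z' w')]
    have h5 : ((-1 : MvPolynomial (Fin 2 ⊕ Fin 2) Q) ^ i) * (-1) ^ i = 1 := by
      rw [← mul_pow]
      simp
    linear_combination (-(linSubst Q g.transpose (linForm planeOf z 1)) ^ b *
      (linSubst Q g.transpose (linForm planeOf z 0)) ^ (n - b) * pairForm z' w' ^ i) * h5
  have hm' : planeMinor z' w' 0 = - planeMinor z w 0 := by
    rw [hm]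
    exact eq_neg_of_add_eq_zero_right h
  simp only [genMap_apply, hm', hs, apolar_C_mul, map_smul, LinearMap.smul_apply, apolar_linSubst]
  refine Finset.sum_congr rfl fun i _ => ?_
  have hi : (i : ℕ) ≤ m := Nat.lt_succ_iff.1 i.2
  rw [neg_pow, Algebra.smul_def]
  -- The signs of s^(m-i) and of M^i combine to one that does not depend on i.
  have h6 : ((-1 : Q)) ^ (m - (i : ℕ)) * (-1) ^ (i : ℕ) = algebraMap K Q ((-1) ^ m) := by
    rw [← pow_add, Nat.sub_add_cancel hi]
    simp
  rw [← h6]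
  ring

end Equivariance

/-! #### The span of the coefficients -/

section Span

variable (z w : Fin 2 ⊕ Fin 2 → Q)

lemma isWeightedHomogeneous_linForm (k k' : Fin 2) :
    IsWeightedHomogeneous (colorWeight planeOf k) (linForm planeOf z k')
      (if k' = k then 1 else 0) := by
  rw [linForm]
  refine IsWeightedHomogeneous.sum _ _ _ fun j _ => ?_
  split_ifs with h1 h2 h2
  · have := (isWeightedHomogeneous_X Q (colorWeight planeOf k) j).C_mul (z j)
    rwa [colorWeight, if_pos (h1.trans h2)] at this
  · have := (isWeightedHomogeneous_X Q (colorWeight planeOf k) j).C_mul (z j)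
    rwa [colorWeight, if_neg (by rw [h1]; exact h2)] at this
  · exact isWeightedHomogeneous_zero _ _ _
  · exact isWeightedHomogeneous_zero _ _ _

lemma isWeightedHomogeneous_genForm (a b i : ℕ) :
    IsWeightedHomogeneous (colorWeight planeOf 0) (genForm z w a b i) (a + i) ∧
    IsWeightedHomogeneous (colorWeight planeOf 1) (genForm z w a b i) (b + i) := by
  constructor
  · have h := (((isWeightedHomogeneous_linForm z 0 0).pow a).mul
      ((isWeightedHomogeneous_linForm z 0 1).pow b)).mul
      ((((isWeightedHomogeneous_linForm z 0 0).mul (isWeightedHomogeneous_linForm w 0 1)).sub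
      ((isWeightedHomogeneous_linForm w 0 0).mul (isWeightedHomogeneous_linForm z 0 1))).pow i)
    simpa [genForm, pairForm] using h
  · have h := (((isWeightedHomogeneous_linForm z 1 0).pow a).mul
      ((isWeightedHomogeneous_linForm z 1 1).pow b)).mul
      ((((isWeightedHomogeneous_linForm z 1 0).mul (isWeightedHomogeneous_linForm w 1 1)).sub
      ((isWeightedHomogeneous_linForm w 1 0).mul (isWeightedHomogeneous_linForm z 1 1))).pow i)
    simpa [genForm, pairForm] using h

lemma factorial_prod_ne_zero [CharZero K] {σ : Type*} (κ : σ →₀ ℕ) :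
    ((κ.prod fun _ n => n.factorial : ℕ) : K) ≠ 0 := by
  rw [Nat.cast_ne_zero, Finsupp.prod, Finset.prod_ne_zero_iff]
  intro j _
  exact Nat.factorial_ne_zero _

/-- A coefficient is the pairing with the monomial divided by its factorials. The bidegree of the
exponent determines b, so summing over b in `sumForm` loses nothing. -/
lemma genSpan_le_range [CharZero K] (n m : ℕ) {x : Q} (hx : x ∈ genSpan K z w n m) :
    ∃ p : Fin (m + 1) → MvPolynomial (Fin 2 ⊕ Fin 2) K,
      (∀ i : Fin (m + 1), p i ∈ bidegSpace K n i) ∧ genMap K z w n m p = x := by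
  have key : genSpan K z w n m ≤ Submodule.map (genMap K z w n m)
      (Submodule.pi Set.univ fun i : Fin (m + 1) => bidegSpace K n i) := by
    refine Submodule.span_le.2 ?_
    rintro _ ⟨a, b, i, κ, hab, hi, rfl⟩
    by_cases hκ : Finsupp.weight (colorWeight planeOf 0) κ = a + i ∧
        Finsupp.weight (colorWeight planeOf 1) κ = b + i
    · refine ⟨Pi.single ⟨i, Nat.lt_succ_of_le hi⟩
        (monomial κ ((κ.prod fun _ n => n.factorial : ℕ) : K)⁻¹), ?_, ?_⟩
      · intro i' _
        by_cases h : i' = ⟨i, Nat.lt_succ_of_le hi⟩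
        · subst h
          rw [Pi.single_eq_same]
          refine (monomial_mem_restrictSupport K).2 (Or.inl ⟨b, by omega, ?_, hκ.2⟩)
          rw [hκ.1, show n - b = a by omega]
        · rw [Pi.single_eq_of_ne h]
          exact Submodule.zero_mem _
      · rw [genMap_apply, Finset.sum_eq_single ⟨i, Nat.lt_succ_of_le hi⟩]
        · rw [Pi.single_eq_same, apolar_monomial, smul_smul,
            inv_mul_cancel₀ (factorial_prod_ne_zero κ), one_smul, sumForm, coeff_sum,
            Finset.sum_eq_single b]
          · rw [show n - b = a by omega]
          · intro b' hb' hne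
            refine (isWeightedHomogeneous_genForm z w _ _ _).2.coeff_eq_zero _ ?_
            rw [hκ.2]
            simpa using hne.symm
          · intro hb
            exact absurd (Finset.mem_range.2 (by omega)) hb
        · intro i' _ h
          rw [Pi.single_eq_of_ne h, map_zero, LinearMap.zero_apply, mul_zero]
        · simp
    · have h0 : coeff κ (genForm z w a b i) = 0 := by
        rw [not_and_or] at hκ
        rcases hκ with hκ | hκ
        · exact (isWeightedHomogeneous_genForm z w a b i).1.coeff_eq_zero _ hκ
        · exact (isWeightedHomogeneous_genForm z w a b i).2.coeff_eq_zero _ hκ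
      rw [h0, mul_zero]
      exact Submodule.zero_mem _
  obtain ⟨p, hp, rfl⟩ := key hx
  exact ⟨p, fun i => hp i trivial, rfl⟩

end Span

end GenMap

/-! ### The generic pair of vectors -/

section Generic

variable {K : Type*} [Field K]

variable (K) in
/-- The generic vector of the slot `k`. -/
def genVec (k : Fin 2) (j : Fin 2 ⊕ Fin 2) : MvPolynomial ((Fin 2 ⊕ Fin 2) × Fin 2) K := X (j, k)

variable (K) in
/-- The polynomials on pairs of vectors that are homogeneous of bidegree `(a, b)` and invariant
under adding multiples of the first vector to the second one. -/
def polarSpace (a b : ℕ) : Submodule K (MvPolynomial ((Fin 2 ⊕ Fin 2) × Fin 2) K) :=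
  weightedHomogeneousSubmodule K (colorWeight Prod.snd 0) a ⊓
    weightedHomogeneousSubmodule K (colorWeight Prod.snd 1) b ⊓
    LinearMap.ker (slotDer (Fin 2 ⊕ Fin 2) K 1 0).toLinearMap

lemma mem_polarSpace {a b : ℕ} {f : MvPolynomial ((Fin 2 ⊕ Fin 2) × Fin 2) K} :
    f ∈ polarSpace K a b ↔ IsWeightedHomogeneous (colorWeight Prod.snd 0) f a ∧
      IsWeightedHomogeneous (colorWeight Prod.snd 1) f b ∧
      slotDer (Fin 2 ⊕ Fin 2) K 1 0 f = 0 := by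
  simp [polarSpace, and_assoc]

lemma mul_mem_polarSpace {a b a' b' : ℕ} {f g : MvPolynomial ((Fin 2 ⊕ Fin 2) × Fin 2) K}
    (hf : f ∈ polarSpace K a b) (hg : g ∈ polarSpace K a' b') :
    f * g ∈ polarSpace K (a + a') (b + b') := by
  rw [mem_polarSpace] at *
  refine ⟨hf.1.mul hg.1, hf.2.1.mul hg.2.1, ?_⟩
  rw [Derivation.leibniz, hf.2.2, hg.2.2]
  simp

lemma pow_mem_polarSpace {a b : ℕ} {f : MvPolynomial ((Fin 2 ⊕ Fin 2) × Fin 2) K}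
    (hf : f ∈ polarSpace K a b) (n : ℕ) : f ^ n ∈ polarSpace K (n * a) (n * b) := by
  rw [mem_polarSpace] at *
  refine ⟨by simpa using hf.1.pow n, by simpa using hf.2.1.pow n, ?_⟩
  rw [Derivation.leibniz_pow, hf.2.2]
  simp

lemma mul_mem_coeffsIn_polarSpace {σ : Type*} {a b a' b' : ℕ}
    {F G : MvPolynomial σ (MvPolynomial ((Fin 2 ⊕ Fin 2) × Fin 2) K)}
    (hF : F ∈ coeffsIn σ (polarSpace K a b)) (hG : G ∈ coeffsIn σ (polarSpace K a' b')) :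
    F * G ∈ coeffsIn σ (polarSpace K (a + a') (b + b')) := by
  have h1 : polarSpace K a b * polarSpace K a' b' ≤ polarSpace K (a + a') (b + b') :=
    Submodule.mul_le.2 fun f hf g hg => mul_mem_polarSpace hf hg
  have h2 : F * G ∈ coeffsIn σ (polarSpace K a b * polarSpace K a' b') := by
    rw [coeffsIn_mul]
    exact Submodule.mul_mem_mul hF hG
  exact fun κ => h1 (h2 κ)

lemma pow_mem_coeffsIn_polarSpace {σ : Type*} {a b : ℕ}
    {F : MvPolynomial σ (MvPolynomial ((Fin 2 ⊕ Fin 2) × Fin 2) K)}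
    (hF : F ∈ coeffsIn σ (polarSpace K a b)) (n : ℕ) :
    F ^ n ∈ coeffsIn σ (polarSpace K (n * a) (n * b)) := by
  induction n with
  | zero =>
    rw [pow_zero, zero_mul, zero_mul, one_coeffsIn, mem_polarSpace]
    exact ⟨isWeightedHomogeneous_one _ _, isWeightedHomogeneous_one _ _, by simp⟩
  | succ n ih =>
    rw [pow_succ, Nat.succ_mul, Nat.succ_mul]
    exact mul_mem_coeffsIn_polarSpace ih hF

lemma genVec_mem (j : Fin 2 ⊕ Fin 2) : genVec K 0 j ∈ polarSpace K 1 0 := by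
  rw [mem_polarSpace]
  refine ⟨?_, ?_, ?_⟩
  · exact isWeightedHomogeneous_X K (colorWeight Prod.snd 0) (j, (0 : Fin 2))
  · exact isWeightedHomogeneous_X K (colorWeight Prod.snd 1) (j, (0 : Fin 2))
  · rw [genVec, slotDer_X]
    simp

lemma genVec_minor_mem (j k : Fin 2 ⊕ Fin 2) :
    genVec K 0 j * genVec K 1 k - genVec K 1 j * genVec K 0 k ∈ polarSpace K 1 1 := by
  rw [mem_polarSpace]
  refine ⟨?_, ?_, ?_⟩
  · exact ((isWeightedHomogeneous_X K (colorWeight Prod.snd 0) (j, (0 : Fin 2))).mul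
      (isWeightedHomogeneous_X K (colorWeight Prod.snd 0) (k, (1 : Fin 2)))).sub
      ((isWeightedHomogeneous_X K (colorWeight Prod.snd 0) (j, (1 : Fin 2))).mul
      (isWeightedHomogeneous_X K (colorWeight Prod.snd 0) (k, (0 : Fin 2))))
  · exact ((isWeightedHomogeneous_X K (colorWeight Prod.snd 1) (j, (0 : Fin 2))).mul
      (isWeightedHomogeneous_X K (colorWeight Prod.snd 1) (k, (1 : Fin 2)))).sub
      ((isWeightedHomogeneous_X K (colorWeight Prod.snd 1) (j, (1 : Fin 2))).mul
      (isWeightedHomogeneous_X K (colorWeight Prod.snd 1) (k, (0 : Fin 2))))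
  · simp only [genVec, map_sub, Derivation.leibniz, slotDer_X]
    simp
    ring

/-- The coefficients are polynomials in the coordinates of z and the minors of (z, w), none of which
changes when a multiple of z is added to w. -/
lemma genForm_mem_polarSpace (a b i : ℕ) :
    genForm (genVec K 0) (genVec K 1) a b i
      ∈ coeffsIn (Fin 2 ⊕ Fin 2) (polarSpace K (a + b + i) i) := by
  have h1 : ∀ k, linForm planeOf (genVec K 0) k
      ∈ coeffsIn (Fin 2 ⊕ Fin 2) (polarSpace K 1 0) := by
    intro k
    rw [linForm_planeOf]
    refine Submodule.add_mem _ ?_ ?_ <;>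
    · rw [mul_X_mem_coeffsIn, C_mem_coeffsIn]
      exact genVec_mem _
  have h2 : pairForm (genVec K 0) (genVec K 1)
      ∈ coeffsIn (Fin 2 ⊕ Fin 2) (polarSpace K 1 1) := by
    have e : pairForm (genVec K 0) (genVec K 1) =
        C (genVec K 0 (.inl 0) * genVec K 1 (.inl 1) - genVec K 1 (.inl 0) * genVec K 0 (.inl 1))
          * X (.inl 0) * X (.inl 1)
        + C (genVec K 0 (.inl 0) * genVec K 1 (.inr 1) - genVec K 1 (.inl 0) * genVec K 0 (.inr 1))
          * X (.inl 0) * X (.inr 1)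
        + C (genVec K 0 (.inr 0) * genVec K 1 (.inl 1) - genVec K 1 (.inr 0) * genVec K 0 (.inl 1))
          * X (.inr 0) * X (.inl 1)
        + C (genVec K 0 (.inr 0) * genVec K 1 (.inr 1) - genVec K 1 (.inr 0) * genVec K 0 (.inr 1))
          * X (.inr 0) * X (.inr 1) := by
      simp only [pairForm, linForm_planeOf, map_sub, map_mul]
      ring
    rw [e]
    refine Submodule.add_mem _ (Submodule.add_mem _ (Submodule.add_mem _ ?_ ?_) ?_) ?_ <;>
    · rw [mul_X_mem_coeffsIn, mul_X_mem_coeffsIn, C_mem_coeffsIn]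
      exact genVec_minor_mem _ _
  have h := mul_mem_coeffsIn_polarSpace (mul_mem_coeffsIn_polarSpace
    (pow_mem_coeffsIn_polarSpace (h1 0) a) (pow_mem_coeffsIn_polarSpace (h1 1) b))
    (pow_mem_coeffsIn_polarSpace h2 i)
  simpa [genForm] using h

lemma genMap_mem_polarSpace (n m : ℕ) (p : Fin (m + 1) → MvPolynomial (Fin 2 ⊕ Fin 2) K) :
    genMap K (genVec K 0) (genVec K 1) n m p ∈ polarSpace K (n + m) m := by
  rw [genMap_apply]
  refine Submodule.sum_mem _ fun i _ => ?_
  have hi : (i : ℕ) ≤ m := Nat.lt_succ_iff.1 i.2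
  have h1 : planeMinor (genVec K 0) (genVec K 1) 0 ∈ polarSpace K 1 1 := by
    have := genVec_minor_mem (K := K) (.inl 0) (.inr 0)
    rwa [mul_comm (genVec K 1 _)] at this
  have h2 : sumForm (genVec K 0) (genVec K 1) n i
      ∈ coeffsIn (Fin 2 ⊕ Fin 2) (polarSpace K (n + i) i) := by
    refine Submodule.sum_mem _ fun b hb => ?_
    have hb' : b ≤ n := by simpa [Nat.lt_succ_iff] using hb
    have := genForm_mem_polarSpace (K := K) (n - b) b i
    rwa [Nat.sub_add_cancel hb'] at this
  have h3 := mul_mem_polarSpace (pow_mem_polarSpace h1 (m - i)) (apolar_mem (p i) h2)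
  rwa [show (m - (i : ℕ)) * 1 + (n + i) = n + m by omega,
    show (m - (i : ℕ)) * 1 + i = m by omega] at h3

end Generic

/-! ### Independence of the summands -/

section Independence

variable {K : Type*} [Field K] [CharZero K]

/-- The pairing with `∑ X^(n-b+i) Y^(b+i)` only rescales the coefficients of the elements of
`bidegSpace K n i`. -/
lemma eq_zero_of_apolar_linForm {n i : ℕ} {p : MvPolynomial (Fin 2 ⊕ Fin 2) K}
    (hp : p ∈ bidegSpace K n i)
    (h : apolar p (∑ b ∈ Finset.range (n + 1),
      linForm planeOf (X : Fin 2 ⊕ Fin 2 → MvPolynomial (Fin 2 ⊕ Fin 2) K) 0 ^ (n - b + i)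
        * linForm planeOf X 1 ^ (b + i)) = 0) : p = 0 := by
  have key : ∀ κ ∈ p.support, ∃ c : ℕ, c ≠ 0 ∧ apolar (monomial κ (coeff κ p))
      (∑ b ∈ Finset.range (n + 1),
      linForm planeOf (X : Fin 2 ⊕ Fin 2 → MvPolynomial (Fin 2 ⊕ Fin 2) K) 0 ^ (n - b + i)
        * linForm planeOf X 1 ^ (b + i)) = monomial κ (c * coeff κ p) := by
    intro κ hκ
    obtain ⟨b₀, hb₀, h0, h1⟩ := (mem_restrictSupport_iff K).1 hp hκ
    -- The reproducing property at the generic point v = X returns the monomial itself, times these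
    -- factorials.
    refine ⟨(n - b₀ + i).factorial * (b₀ + i).factorial, by positivity, ?_⟩
    rw [map_sum, Finset.sum_eq_single b₀]
    · rw [apolar_monomial_linForm _ _ _ _ _ _ (isWeightedHomogeneous_monomial _ _ _ h0)
        (isWeightedHomogeneous_monomial _ _ _ h1), if_pos ⟨rfl, rfl⟩, aeval_X_left_apply]
      rw [← C_mul_monomial]
      simp
    · intro b _ hb
      rw [apolar_monomial_linForm _ _ _ _ _ _ (isWeightedHomogeneous_monomial _ _ _ h0)
        (isWeightedHomogeneous_monomial _ _ _ h1), if_neg]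
      omega
    · intro hb
      exact absurd (Finset.mem_range.2 (by omega)) hb
  choose! c hc hc' using key
  ext κ
  by_contra hκ
  rw [coeff_zero] at hκ
  generalize ∑ b ∈ Finset.range (n + 1),
      linForm planeOf (X : Fin 2 ⊕ Fin 2 → MvPolynomial (Fin 2 ⊕ Fin 2) K) 0 ^ (n - b + i)
        * linForm planeOf X 1 ^ (b + i) = F at h hc'
  rw [p.as_sum, map_sum, LinearMap.sum_apply, Finset.sum_congr rfl hc'] at h
  have h2 := congrArg (coeff κ) h
  rw [coeff_sum, Finset.sum_eq_single κ] at h2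
  · rw [coeff_monomial, if_pos rfl, coeff_zero, mul_eq_zero] at h2
    rcases h2 with h2 | h2
    · exact hc κ (mem_support_iff.2 hκ) (by exact_mod_cast h2)
    · exact hκ h2
  · intro κ' _ hne
    rw [coeff_monomial, if_neg hne]
  · intro hn
    exact absurd (mem_support_iff.2 hκ) hn

/-- A vector that spans an isotropic plane together with `v`. -/
def isoVec {R : Type*} [CommRing R] (v : Fin 2 ⊕ Fin 2 → R) (t : R) : Fin 2 ⊕ Fin 2 → R :=
  Sum.elim ![0, v (.inl 1)] ![- (v (.inl 1) * t), v (.inr 1) + v (.inl 0) * t]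

/-- Along this family s is a multiple of t. At t = 0 the second vector is the component of v in the
second plane, so M = XY and the generating form becomes X^(a+i) Y^(b+i). -/
lemma planeMinor_isoVec {R : Type*} [CommRing R] (v : Fin 2 ⊕ Fin 2 → R) (t : R) :
    planeMinor v (isoVec v t) 0 = - (v (.inl 0) * v (.inl 1)) * t := by
  simp [planeMinor, isoVec]
  ring

lemma sumForm_isoVec_zero {R : Type*} [CommRing R] (v : Fin 2 ⊕ Fin 2 → R) (n i : ℕ) :
    sumForm v (isoVec v 0) n i = ∑ b ∈ Finset.range (n + 1),
      linForm planeOf v 0 ^ (n - b + i) * linForm planeOf v 1 ^ (b + i) := by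
  have e : pairForm v (isoVec v 0) = linForm planeOf v 0 * linForm planeOf v 1 := by
    simp [pairForm, linForm_planeOf, isoVec]
  rw [sumForm]
  refine Finset.sum_congr rfl fun b _ => ?_
  rw [genForm, e]
  ring

lemma comp_isoVec {R Q Q' : Type*} [CommRing R] [CommRing Q] [Algebra R Q] [CommRing Q']
    [Algebra R Q'] (φ : Q →ₐ[R] Q') (v : Fin 2 ⊕ Fin 2 → Q) (t : Q) :
    φ ∘ isoVec v t = isoVec (φ ∘ v) (φ t) := by
  funext j
  rcases j with j | j <;> fin_cases j <;> simp [isoVec]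

/-- The lowest order term of the pairing with the generating forms along a degeneration. -/
lemma apolar_sumForm_eq_zero_of_genMap {n m : ℕ}
    {p : Fin (m + 1) → MvPolynomial (Fin 2 ⊕ Fin 2) K} {i₀ : Fin (m + 1)}
    (hi₀ : ∀ i, i₀ < i → p i = 0) {v : Fin 2 ⊕ Fin 2 → K} (hv : v (.inl 0) * v (.inl 1) ≠ 0)
    (h : ∀ t : K, genMap K v (isoVec v t) n m p = 0) :
    apolar (p i₀) (sumForm v (isoVec v 0) n i₀) = 0 := by
  set v' : Fin 2 ⊕ Fin 2 → Polynomial K := fun j => Polynomial.C (v j) with hv'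
  have hφ : ∀ t : K, (Polynomial.aeval t : Polynomial K →ₐ[K] K) ∘ v' = v := by
    intro t
    funext j
    simp [hv']
  have hF : genMap K v' (isoVec v' Polynomial.X) n m p = 0 := by
    refine Polynomial.funext fun t => ?_
    have e := map_genMap (Polynomial.aeval t : Polynomial K →ₐ[K] K) v'
      (isoVec v' Polynomial.X) n m p
    rw [comp_isoVec, hφ, Polynomial.aeval_X, h t] at e
    rw [Polynomial.eval_zero, ← Polynomial.coe_aeval_eq_eval]
    exact e
  set E : Fin (m + 1) → Polynomial K := fun i => apolar (p i)
    (sumForm v' (isoVec v' Polynomial.X) n i) with hE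
  set c : K := - (v (.inl 0) * v (.inl 1)) with hc
  have hc0 : c ≠ 0 := neg_ne_zero.2 hv
  have h1 : ∀ i : Fin (m + 1), planeMinor v' (isoVec v' Polynomial.X) 0 ^ (m - i : ℕ) * E i
      = Polynomial.C (c ^ (m - i : ℕ)) * (Polynomial.X ^ (m - i : ℕ) * E i) := by
    intro i
    have : - (v' (.inl 0) * v' (.inl 1)) = Polynomial.C c := by simp [hv', hc]
    rw [planeMinor_isoVec, this, mul_pow, Polynomial.C_pow, mul_assoc]
  rw [genMap_apply, Finset.sum_congr rfl fun i _ => h1 i] at hF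
  have h2 := congrArg (fun q => Polynomial.coeff q (m - i₀)) hF
  simp only [Polynomial.finsetSum_coeff, Polynomial.coeff_C_mul, Polynomial.coeff_zero] at h2
  -- The i-th term is divisible by t^(m-i): for i < i₀ it has only powers higher than m - i₀, and
  -- for i > i₀ it vanishes.
  rw [Finset.sum_eq_single i₀] at h2
  · rw [Polynomial.coeff_X_pow_mul', if_pos le_rfl, Nat.sub_self, mul_eq_zero,
      Polynomial.coeff_zero_eq_eval_zero, ← Polynomial.coe_aeval_eq_eval] at h2
    have h3 := h2.resolve_left (pow_ne_zero _ hc0)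
    have h4 := map_apolar (Polynomial.aeval (0 : K) : Polynomial K →ₐ[K] K) (p i₀)
      (sumForm v' (isoVec v' Polynomial.X) n i₀)
    rw [map_sumForm, comp_isoVec, hφ, Polynomial.aeval_X] at h4
    exact h4.symm.trans h3
  · intro i _ hi
    rcases lt_or_gt_of_ne hi with hlt | hgt
    · have h5 : (i : ℕ) < i₀ := hlt
      have h6 : (i₀ : ℕ) ≤ m := Nat.lt_succ_iff.1 i₀.2
      rw [Polynomial.coeff_X_pow_mul', if_neg (by omega), mul_zero]
    · simp [hE, hi₀ i hgt]
  · simp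

/-- If p ≠ 0, take the largest i₀ with p i₀ ≠ 0. The lowest order term in t forces the pairing of p
i₀ with the degenerate forms to vanish, and that pairing only rescales coefficients. -/
lemma eq_zero_of_genMap {n m : ℕ} {p : Fin (m + 1) → MvPolynomial (Fin 2 ⊕ Fin 2) K}
    (hp : ∀ i : Fin (m + 1), p i ∈ bidegSpace K n i)
    (h : ∀ (v : Fin 2 ⊕ Fin 2 → K) (t : K), v (.inl 0) * v (.inl 1) ≠ 0 →
      genMap K v (isoVec v t) n m p = 0) : p = 0 := by
  classical
  by_contra hne
  obtain ⟨i₁, hi₁⟩ := Function.ne_iff.1 hne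
  obtain ⟨i₀, hi₀, hmax⟩ := Finset.exists_max_image
    (Finset.univ.filter fun i => p i ≠ 0) id ⟨i₁, by simpa using hi₁⟩
  refine (Finset.mem_filter.1 hi₀).2 (eq_zero_of_apolar_linForm (hp i₀) ?_)
  have hi₀' : ∀ i, i₀ < i → p i = 0 := by
    intro i hi
    by_contra hpi
    exact absurd hi (not_lt.2 (hmax i (by simpa using hpi)))
  rw [← sumForm_isoVec_zero]
  set F : MvPolynomial (Fin 2 ⊕ Fin 2) K := apolar (p i₀)
    (sumForm (X : Fin 2 ⊕ Fin 2 → MvPolynomial (Fin 2 ⊕ Fin 2) K) (isoVec X 0) n i₀) with hF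
  -- Vanishing of F is known only where the product of these two coordinates is nonzero; multiplying
  -- by it covers all points.
  have h4 : X (.inl 0) * X (.inl 1) * F = 0 := by
    refine MvPolynomial.funext fun v => ?_
    rw [map_mul, map_mul, eval_X, eval_X, map_zero]
    by_cases hv : v (.inl 0) * v (.inl 1) = 0
    · rw [hv, zero_mul]
    have e := map_apolar (aeval v : MvPolynomial (Fin 2 ⊕ Fin 2) K →ₐ[K] K) (p i₀)
      (sumForm (X : Fin 2 ⊕ Fin 2 → MvPolynomial (Fin 2 ⊕ Fin 2) K) (isoVec X 0) n i₀)
    have hX : (aeval v : MvPolynomial (Fin 2 ⊕ Fin 2) K →ₐ[K] K) ∘ X = v := by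
      funext j
      simp
    rw [map_sumForm, comp_isoVec, hX, map_zero,
      apolar_sumForm_eq_zero_of_genMap hi₀' hv fun t => h v t hv, ← hF] at e
    have e' : eval v F = 0 := by
      rw [← coe_aeval_eq_eval]
      exact e
    rw [e', mul_zero]
  simpa [X_ne_zero] using h4

end Independence

/-! ### Generic lemmas on representations -/

section General

/-- Identify both spaces with their common range. `T` is merely a family of functions, so no
representation on `Z` has to be set up. -/
lemma nonempty_equiv_of_injective {K G X Y Z : Type*} [Field K] [Monoid G] [AddCommMonoid X]
    [Module K X] [AddCommMonoid Y] [Module K Y] [AddCommMonoid Z] [Module K Z]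
    (ρ : Representation K G X) (σ : Representation K G Y) (u : X →ₗ[K] Z) (v : Y →ₗ[K] Z)
    (T : G → Z → Z) (hu : Function.Injective u) (hv : Function.Injective v)
    (huv : LinearMap.range u = LinearMap.range v) (hρ : ∀ g x, u (ρ g x) = T g (u x))
    (hσ : ∀ g y, v (σ g y) = T g (v y)) : Nonempty (Representation.Equiv ρ σ) := by
  let e : X ≃ₗ[K] Y := (LinearEquiv.ofInjective u hu).trans
    ((LinearEquiv.ofEq _ _ huv).trans (LinearEquiv.ofInjective v hv).symm)
  have he : ∀ x, v (e x) = u x := by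
    intro x
    have h := LinearEquiv.apply_symm_apply (LinearEquiv.ofInjective v hv)
      (LinearEquiv.ofEq _ _ huv (LinearEquiv.ofInjective u hu x))
    exact congrArg Subtype.val h
  refine ⟨Representation.Equiv.mk e fun g => LinearMap.ext fun x => hv ?_⟩
  change v (e (ρ g x)) = v (σ g (e x))
  rw [he, hσ, he, hρ]

end General

/-! ### Reduction modulo the symplectic form and the dimension count -/

section Quotient

variable (K : Type*) [Field K]

/-- The functions on pairs of vectors, modulo the symplectic form. -/
abbrev SymplQuot : Type _ :=
  MvPolynomial ((Fin 2 ⊕ Fin 2) × Fin 2) K ⧸ Ideal.span {symplForm K}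

/-- The generic vectors of an isotropic plane. -/
def isoGenVec (k : Fin 2) (j : Fin 2 ⊕ Fin 2) : SymplQuot K :=
  Ideal.Quotient.mkₐ K _ (genVec K k j)

variable {K}

lemma planeMinor_isoGenVec :
    planeMinor (isoGenVec K 0) (isoGenVec K 1) 0 + planeMinor (isoGenVec K 0) (isoGenVec K 1) 1
      = 0 := by
  have h : Ideal.Quotient.mkₐ K (Ideal.span {symplForm K}) (symplForm K) = 0 :=
    Ideal.Quotient.eq_zero_iff_mem.2 (Ideal.subset_span rfl)
  have e : planeMinor (genVec K 0) (genVec K 1) 0 + planeMinor (genVec K 0) (genVec K 1) 1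
      = symplForm K := by
    simp [planeMinor, symplForm, genVec]
    ring
  rw [← h]
  refine Eq.trans ?_ (congrArg (Ideal.Quotient.mkₐ K (Ideal.span {symplForm K})) e)
  simp only [planeMinor, isoGenVec, map_add, map_sub, map_mul]

lemma linSubst_mem_span_symplForm (g : Sp4 K) :
    Ideal.span {symplForm K} ≤ (Ideal.span {symplForm K}).comap
      ((linSubst K (g.1 ⊗ₖ (1 : Matrix (Fin 2) (Fin 2) K))).restrictScalars K) := by
  rw [Ideal.span_le, Set.singleton_subset_iff]
  change _ ∈ Ideal.span _
  rw [AlgHom.restrictScalars_apply, linSubst_symplForm g.2]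
  exact Ideal.subset_span rfl

/-- The action of `Sp₄` on functions on pairs of vectors, modulo the symplectic form. -/
def symplQuotHom (g : Sp4 K) : SymplQuot K →ₐ[K] SymplQuot K :=
  Ideal.quotientMapₐ _ _ (linSubst_mem_span_symplForm g)

lemma symplQuotHom_mk (g : Sp4 K) (f : MvPolynomial ((Fin 2 ⊕ Fin 2) × Fin 2) K) :
    symplQuotHom g (Ideal.Quotient.mkₐ K _ f) = Ideal.Quotient.mkₐ K _ (symWW K g f) := by
  rw [symWW_apply]
  rfl

lemma symplQuotHom_isoGenVec (g : Sp4 K) (k : Fin 2) (j : Fin 2 ⊕ Fin 2) :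
    symplQuotHom g (isoGenVec K k j) = ∑ i, g.1 i j • isoGenVec K k i := by
  rw [isoGenVec, symplQuotHom_mk, symWW_apply, genVec, linSubst_kronecker_X, map_sum]
  simp only [map_smul]
  rfl

lemma highestVector_symWW (g : Sp4 K) (l m : ℕ) :
    symWW K g (highestVector K l m) = slotForm (fun j => g.1 j (.inl 0)) 0 ^ (l - m) *
      (slotForm (fun j => g.1 j (.inl 0)) 0 * slotForm (fun j => g.1 j (.inl 1)) 1
      - slotForm (fun j => g.1 j (.inl 1)) 0 * slotForm (fun j => g.1 j (.inl 0)) 1) ^ m := by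
  rw [symWW_apply, highestVector]
  simp only [map_mul, map_pow, map_sub, linSubst_kronecker_X, slotForm, smul_eq_C_mul]

/-- In the lower block triangular matrix the left blocks A, C hold the prescribed columns and D is
the inverse transpose of A. Symmetry of AᵀC is the isotropy of the two columns. -/
lemma exists_isoVec (v : Fin 2 ⊕ Fin 2 → K) (t : K) (hv : v (.inl 0) * v (.inl 1) ≠ 0) :
    ∃ g : Sp4 K, (fun j => g.1 j (.inl 0)) = v ∧ (fun j => g.1 j (.inl 1)) = isoVec v t := by
  have h0 : v (.inl 0) ≠ 0 := left_ne_zero_of_mul hv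
  have h1 : v (.inl 1) ≠ 0 := right_ne_zero_of_mul hv
  refine ⟨⟨Matrix.fromBlocks !![v (.inl 0), 0; v (.inl 1), v (.inl 1)] 0
    !![v (.inr 0), -(v (.inl 1) * t); v (.inr 1), v (.inr 1) + v (.inl 0) * t]
    !![(v (.inl 0))⁻¹, -(v (.inl 0))⁻¹; 0, (v (.inl 1))⁻¹], ?_⟩, ?_, ?_⟩
  · rw [SymplecticGroup.fromBlocks_mem_iff]
    refine ⟨?_, ?_, ?_⟩
    · ext i j
      fin_cases i <;> fin_cases j <;>
        simp [Matrix.mul_apply, Fin.sum_univ_two] <;> ring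
    · simp
    · ext i j
      fin_cases i <;> fin_cases j <;>
        simp [Matrix.mul_apply, Fin.sum_univ_two, h0, h1]
  · funext j
    rcases j with j | j <;> fin_cases j <;> simp
  · funext j
    rcases j with j | j <;> fin_cases j <;> simp [isoVec]

variable [CharZero K]

lemma mkₐ_mem_genSpan {l m : ℕ} {f : MvPolynomial ((Fin 2 ⊕ Fin 2) × Fin 2) K}
    (hf : f ∈ WSpace K l m) : Ideal.Quotient.mkₐ K (Ideal.span {symplForm K}) f
      ∈ genSpan K (isoGenVec K 0) (isoGenVec K 1) (l - m) m := by
  have : WSpace K l m ≤ (genSpan K (isoGenVec K 0) (isoGenVec K 1) (l - m) m).comap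
      (Ideal.Quotient.mkₐ K (Ideal.span {symplForm K})).toLinearMap := by
    refine Submodule.span_le.2 ?_
    rintro _ ⟨g, rfl⟩
    have h := pow_mul_pow_mem_genSpan (K := K) (planeMinor_isoGenVec (K := K))
      (fun j => g.1 j (.inl 0)) (fun j => g.1 j (.inl 1)) (l - m) m
    change Ideal.Quotient.mkₐ K (Ideal.span {symplForm K}) (symWW K g (highestVector K l m))
      ∈ genSpan K (isoGenVec K 0) (isoGenVec K 1) (l - m) m
    rw [highestVector_symWW]
    have e : ∀ (v : Fin 2 ⊕ Fin 2 → K) (k : Fin 2),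
        Ideal.Quotient.mkₐ K (Ideal.span {symplForm K}) (slotForm v k)
          = ∑ j, v j • isoGenVec K k j := by
      intro v k
      simp only [slotForm, map_sum, ← smul_eq_C_mul, map_smul]
      rfl
    simp only [map_mul, map_pow, map_sub, e]
    exact h
  exact this hf

lemma injOn_WSpace (l m : ℕ) : Function.Injective
    ((Ideal.Quotient.mkₐ K (Ideal.span {symplForm K})).toLinearMap ∘ₗ (WSpace K l m).subtype) := by
  rw [injective_iff_map_eq_zero]
  rintro ⟨f, hf⟩ h
  exact Subtype.ext (eq_zero_of_mem_span_symplForm (Ideal.Quotient.eq_zero_iff_mem.1 h)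
    (symplLaplacian_of_mem_WSpace hf))

lemma eq_zero_of_genMap_isoGenVec {n m : ℕ} {p : Fin (m + 1) → MvPolynomial (Fin 2 ⊕ Fin 2) K}
    (hp : ∀ i : Fin (m + 1), p i ∈ bidegSpace K n i)
    (h : genMap K (isoGenVec K 0) (isoGenVec K 1) n m p = 0) : p = 0 := by
  refine eq_zero_of_genMap hp fun v t _ => ?_
  have hq : ∀ a ∈ Ideal.span {symplForm K},
      (aeval (slotPoint v (isoVec v t)) : _ →ₐ[K] K) a = 0 := by
    intro a ha
    obtain ⟨b, rfl⟩ := Ideal.mem_span_singleton.1 ha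
    rw [map_mul]
    convert zero_mul _
    simp [symplForm, slotPoint, isoVec]
    ring
  have e := map_genMap (Ideal.Quotient.liftₐ _ _ hq) (isoGenVec K 0) (isoGenVec K 1) n m p
  rw [h, map_zero] at e
  have hk : ∀ k, Ideal.Quotient.liftₐ _ _ hq ∘ isoGenVec K k = ![v, isoVec v t] k := by
    intro k
    funext j
    change (aeval (slotPoint v (isoVec v t)) : _ →ₐ[K] K) (X (j, k)) = _
    rw [aeval_X]
    fin_cases k <;> simp [slotPoint]
  rw [hk, hk] at e
  exact e.symm

/-- Orthogonality to the translates of the highest weight vector forces the image of p to vanish at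
all pairs (v, isoVec v t) with v as in `exists_isoVec`, and these pairs suffice for
`eq_zero_of_genMap`. -/
lemma eq_zero_of_apolar_WSpace {l m : ℕ} (hml : m ≤ l)
    {p : Fin (m + 1) → MvPolynomial (Fin 2 ⊕ Fin 2) K}
    (hp : ∀ i : Fin (m + 1), p i ∈ bidegSpace K (l - m) i)
    (h : ∀ f ∈ WSpace K l m, apolar f (genMap K (genVec K 0) (genVec K 1) (l - m) m p) = 0) :
    p = 0 := by
  refine eq_zero_of_genMap hp fun v t hv => ?_
  obtain ⟨g, hg0, hg1⟩ := exists_isoVec v t hv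
  have hP := genMap_mem_polarSpace (l - m) m p
  rw [Nat.sub_add_cancel hml, mem_polarSpace] at hP
  have h1 := h _ (Submodule.subset_span ⟨g, rfl⟩)
  simp only [highestVector_symWW, hg0, hg1] at h1
  have h2 := eval_eq_zero_of_apolar v (isoVec v t) hP.2.2 hml hP.1 hP.2.1 h1
  have e := map_genMap (aeval (slotPoint v (isoVec v t)) : _ →ₐ[K] K) (genVec K 0) (genVec K 1)
    (l - m) m p
  have hk : ∀ k, (aeval (slotPoint v (isoVec v t)) : _ →ₐ[K] K) ∘ genVec K k
      = ![v, isoVec v t] k := by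
    intro k
    funext j
    change (aeval (slotPoint v (isoVec v t)) : _ →ₐ[K] K) (X (j, k)) = _
    rw [aeval_X]
    fin_cases k <;> simp [slotPoint]
  rw [hk, hk] at e
  refine e.symm.trans ?_
  rw [← h2, ← coe_aeval_eq_eval]
  rfl

instance finite_bidegSpace (n i : ℕ) : Module.Finite K (bidegSpace K n i) := by
  have hle : bidegSpace K n i ≤ restrictTotalDegree (Fin 2 ⊕ Fin 2) K (n + 2 * i) := by
    intro p hp
    rw [mem_restrictTotalDegree]
    refine Finset.sup_le fun κ hκ => ?_
    obtain ⟨b, hb, h0, h1⟩ := (mem_restrictSupport_iff K).1 hp hκ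
    have h2 : (κ.sum fun _ e => e) = Finsupp.weight (colorWeight planeOf 0) κ
        + Finsupp.weight (colorWeight planeOf 1) κ := by
      rw [Finsupp.weight_apply, Finsupp.weight_apply, ← Finsupp.sum_add]
      refine Finsupp.sum_congr fun j _ => ?_
      rcases planeOf_cases j with hj | hj <;> simp [colorWeight, hj]
    omega
  exact Submodule.finiteDimensional_of_le hle

/-- The image of `W_{l,m}` modulo the symplectic form is the sum of the images of the summands. -/
lemma map_WSpace_eq {l m : ℕ} (hml : m ≤ l) :
    (WSpace K l m).map (Ideal.Quotient.mkₐ K (Ideal.span {symplForm K})).toLinearMap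
      = (Submodule.pi Set.univ fun i : Fin (m + 1) => bidegSpace K (l - m) i).map
        (genMap K (isoGenVec K 0) (isoGenVec K 1) (l - m) m) := by
  set E := Submodule.pi Set.univ fun i : Fin (m + 1) => bidegSpace K (l - m) i with hE
  set u := (Ideal.Quotient.mkₐ K (Ideal.span {symplForm K})).toLinearMap ∘ₗ (WSpace K l m).subtype
    with hu
  set v := genMap K (isoGenVec K 0) (isoGenVec K 1) (l - m) m ∘ₗ E.subtype with hv
  have hur : (WSpace K l m).map (Ideal.Quotient.mkₐ K (Ideal.span {symplForm K})).toLinearMap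
      = LinearMap.range u := by
    rw [hu, LinearMap.range_comp, Submodule.range_subtype]
  have hvr : E.map (genMap K (isoGenVec K 0) (isoGenVec K 1) (l - m) m) = LinearMap.range v := by
    rw [hv, LinearMap.range_comp, Submodule.range_subtype]
  have hui : Function.Injective u := injOn_WSpace l m
  have hvi : Function.Injective v := by
    rw [injective_iff_map_eq_zero]
    rintro ⟨p, hp⟩ h
    exact Subtype.ext (eq_zero_of_genMap_isoGenVec (fun i => hp i trivial) h)
  have hfin : Module.Finite K E := by
    let r : E →ₗ[K] ∀ i : Fin (m + 1), bidegSpace K (l - m) i :=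
      LinearMap.pi fun i => (LinearMap.proj i ∘ₗ E.subtype).codRestrict _ fun p => p.2 i trivial
    refine Module.Finite.of_injective r fun p p' h => Subtype.ext (funext fun i => ?_)
    exact congrArg Subtype.val (congrFun h i)
  have hle : LinearMap.range u ≤ LinearMap.range v := by
    rintro _ ⟨f, rfl⟩
    obtain ⟨p, hp, h⟩ := genSpan_le_range _ _ _ _ (mkₐ_mem_genSpan f.2)
    exact ⟨⟨p, fun i _ => hp i⟩, h⟩
  -- The inclusion of ranges bounds dim W by dim E; this injection into the dual of W gives the
  -- opposite bound.
  let d : E →ₗ[K] Module.Dual K (WSpace K l m) :=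
    (LinearMap.lcomp K K (WSpace K l m).subtype) ∘ₗ apolar.flip ∘ₗ
      genMap K (genVec K 0) (genVec K 1) (l - m) m ∘ₗ E.subtype
  have hd : Function.Injective d := by
    rw [injective_iff_map_eq_zero]
    rintro ⟨p, hp⟩ h
    refine Subtype.ext (eq_zero_of_apolar_WSpace hml (fun i => hp i trivial) fun f hf => ?_)
    exact LinearMap.congr_fun h ⟨f, hf⟩
  have hWfin : Module.Finite K (WSpace K l m) := by
    have : Module.Finite K (LinearMap.range u) := Submodule.finiteDimensional_of_le hle
    exact Module.Finite.equiv (LinearEquiv.ofInjective u hui).symm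
  rw [hur, hvr]
  refine Submodule.eq_of_le_of_finrank_le hle ?_
  rw [LinearMap.finrank_range_of_inj hui, LinearMap.finrank_range_of_inj hvi,
    ← Subspace.dual_finrank_eq (K := K) (V := WSpace K l m)]
  exact LinearMap.finrank_le_finrank_of_injective (f := d) hd

end Quotient

/-! ### The main criterion -/

section Criterion

variable {K : Type*} [Field K]

lemma wrHom_inl (g : Fin 2 → Sp2 K) : wrHom (SemidirectProduct.inl g : Wr K) = blockHom g :=
  SemidirectProduct.lift_inl _ _ _ _

lemma wrHom_inr (σ : Equiv.Perm (Fin 2)) :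
    wrHom (SemidirectProduct.inr σ : Wr K) = permHom σ :=
  SemidirectProduct.lift_inr _ _ _ _

lemma genMap_block (g : Fin 2 → Sp2 K) (n m : ℕ)
    (p : Fin (m + 1) → MvPolynomial (Fin 2 ⊕ Fin 2) K) :
    symplQuotHom (blockHom g) (genMap K (isoGenVec K 0) (isoGenVec K 1) n m p)
      = genMap K (isoGenVec K 0) (isoGenVec K 1) n m
        fun i => symRep K _ (blockHom g).1 (p i) := by
  rw [map_genMap]
  simp only [symRep_eq_linSubst]
  refine genMap_transform_one (z' := symplQuotHom (blockHom g) ∘ isoGenVec K 0)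
    (w' := symplQuotHom (blockHom g) ∘ isoGenVec K 1) (z := isoGenVec K 0) (w := isoGenVec K 1)
    (g := (blockHom g).1) (fun j => symplQuotHom_isoGenVec _ _ _)
    (fun j => symplQuotHom_isoGenVec _ _ _) ?_ ?_ n m p
  · intro i j hij
    rcases i with i | i <;> rcases j with j | j <;>
    · have : i ≠ j := hij
      simp [blockHom, blockMatrix, this]
  · have hd := congrArg (algebraMap K (SymplQuot K)) (sp2_det (g 0))
    simp only [map_sub, map_mul, map_one] at hd
    have e₁ : (blockHom g).1 (.inl 0) (.inl 0) = (g 0).1 (.inl 0) (.inl 0) := rfl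
    have e₂ : (blockHom g).1 (.inl 1) (.inl 0) = 0 := rfl
    have e₃ : (blockHom g).1 (.inr 0) (.inl 0) = (g 0).1 (.inr 0) (.inl 0) := rfl
    have e₄ : (blockHom g).1 (.inr 1) (.inl 0) = 0 := rfl
    have e₅ : (blockHom g).1 (.inl 0) (.inr 0) = (g 0).1 (.inl 0) (.inr 0) := rfl
    have e₆ : (blockHom g).1 (.inl 1) (.inr 0) = 0 := rfl
    have e₇ : (blockHom g).1 (.inr 0) (.inr 0) = (g 0).1 (.inr 0) (.inr 0) := rfl
    have e₈ : (blockHom g).1 (.inr 1) (.inr 0) = 0 := rfl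
    have hs : ∀ (c : K) (x : SymplQuot K), c • x = algebraMap K (SymplQuot K) c * x :=
      fun c x => Algebra.smul_def c x
    simp only [planeMinor, Function.comp_apply, symplQuotHom_isoGenVec, Fintype.sum_sum_type,
      Fin.sum_univ_two, e₁, e₂, e₃, e₄, e₅, e₆, e₇, e₈, hs, map_zero, zero_mul,
      add_zero]
    linear_combination (isoGenVec K 0 (.inl 0) * isoGenVec K 1 (.inr 0)
      - isoGenVec K 0 (.inr 0) * isoGenVec K 1 (.inl 0)) * hd

lemma genMap_swap (n m : ℕ) (p : Fin (m + 1) → MvPolynomial (Fin 2 ⊕ Fin 2) K) :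
    symplQuotHom (permHom (Equiv.swap 0 1)) (genMap K (isoGenVec K 0) (isoGenVec K 1) n m p)
      = genMap K (isoGenVec K 0) (isoGenVec K 1) n m
        fun i => (-1 : K) ^ m • symRep K _ (permHom (Equiv.swap 0 1)).1 (p i) := by
  rw [map_genMap]
  simp only [symRep_eq_linSubst]
  refine genMap_transform_swap (z' := symplQuotHom (permHom (Equiv.swap 0 1)) ∘ isoGenVec K 0)
    (w' := symplQuotHom (permHom (Equiv.swap 0 1)) ∘ isoGenVec K 1) (z := isoGenVec K 0)
    (w := isoGenVec K 1) (g := (permHom (Equiv.swap 0 1)).1) planeMinor_isoGenVec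
    (fun j => symplQuotHom_isoGenVec _ _ _)
    (fun j => symplQuotHom_isoGenVec _ _ _) ?_ ?_ n m p
  · intro i j
    rcases i with i | i <;> rcases j with j | j <;> fin_cases i <;> fin_cases j <;>
      simp [permHom, permMatrix, planeOf, Equiv.Perm.permMatrix, PEquiv.toMatrix_apply]
  · simp only [planeMinor, Function.comp_apply, symplQuotHom_isoGenVec, Fintype.sum_sum_type,
      Fin.sum_univ_two]
    simp [permHom, permMatrix, Equiv.Perm.permMatrix, PEquiv.toMatrix_apply]

/-- A representation of the wreath product is the restriction of `W_{l,m}` if it is the direct sum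
of representations that are isomorphic to the spaces `bidegSpace K (l - m) i`, where the
transposition acts with the sign `(-1)^m`. -/
theorem nonempty_equiv_directSum [CharZero K] {l m : ℕ} (hml : m ≤ l) {D : Fin (m + 1) → Type*}
    [∀ i, AddCommMonoid (D i)] [∀ i, Module K (D i)] (ρ : ∀ i, Representation K (Wr K) (D i))
    (P : ∀ i, D i →ₗ[K] MvPolynomial (Fin 2 ⊕ Fin 2) K)
    (hinj : ∀ i, Function.Injective (P i))
    (hrange : ∀ i, LinearMap.range (P i) = bidegSpace K (l - m) i)
    (hblock : ∀ i g x, P i (ρ i (SemidirectProduct.inl g) x)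
      = symRep K _ (blockHom g).1 (P i x))
    (hswap : ∀ i x, P i (ρ i (SemidirectProduct.inr (Equiv.swap 0 1)) x)
      = (-1 : K) ^ m • symRep K _ (permHom (Equiv.swap 0 1)).1 (P i x)) :
    Nonempty (Representation.Equiv ((W K l m).comp wrHom) (Representation.directSum ρ)) := by
  let PP : (⨁ i, D i) →ₗ[K] (Fin (m + 1) → MvPolynomial (Fin 2 ⊕ Fin 2) K) :=
    LinearMap.pi fun i => P i ∘ₗ DirectSum.component K _ _ i
  have hPP : ∀ x i, PP x i = P i (x i) := fun x i => rfl
  have hPPr : LinearMap.range PP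
      = Submodule.pi Set.univ fun i : Fin (m + 1) => bidegSpace K (l - m) i := by
    ext p
    constructor
    · rintro ⟨x, rfl⟩ i -
      exact (hrange i).le ⟨_, rfl⟩
    · intro hp
      have : ∀ i, ∃ y, P i y = p i := fun i => (hrange i).ge (hp i trivial)
      choose y hy using this
      refine ⟨(DirectSum.linearEquivFunOnFintype K (Fin (m + 1)) D).symm y, ?_⟩
      funext i
      rw [hPP, ← hy i]
      congr 1
  have hPPb : ∀ g x, PP (Representation.directSum ρ (SemidirectProduct.inl g) x)
      = fun i => symRep K _ (blockHom g).1 (PP x i) := by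
    intro g x
    funext i
    rw [hPP, hPP, ← hblock]
    rfl
  have hPPs : ∀ x, PP (Representation.directSum ρ (SemidirectProduct.inr (Equiv.swap 0 1)) x)
      = fun i => (-1 : K) ^ m • symRep K _ (permHom (Equiv.swap 0 1)).1 (PP x i) := by
    intro x
    funext i
    rw [hPP, hPP, ← hswap]
    rfl
  refine nonempty_equiv_of_injective _ _
    ((Ideal.Quotient.mkₐ K (Ideal.span {symplForm K})).toLinearMap ∘ₗ (WSpace K l m).subtype)
    (genMap K (isoGenVec K 0) (isoGenVec K 1) (l - m) m ∘ₗ PP)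
    (fun γ => symplQuotHom (wrHom γ)) (injOn_WSpace l m) ?_ ?_ ?_ ?_
  · intro x y hxy
    have h := eq_zero_of_genMap_isoGenVec (p := PP x - PP y) (n := l - m) (m := m) ?_ ?_
    · rw [sub_eq_zero] at h
      refine DFinsupp.ext fun i => hinj i ?_
      exact congrFun h i
    · intro i
      exact Submodule.sub_mem _ (by rw [hPP, ← hrange]; exact ⟨_, rfl⟩)
        (by rw [hPP, ← hrange]; exact ⟨_, rfl⟩)
    · rw [map_sub, sub_eq_zero]
      exact hxy
  · rw [LinearMap.range_comp, LinearMap.range_comp, Submodule.range_subtype, hPPr,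
      map_WSpace_eq hml]
  · intro γ f
    exact (symplQuotHom_mk (wrHom γ) f.1).symm
  · have hl : ∀ g x, (genMap K (isoGenVec K 0) (isoGenVec K 1) (l - m) m ∘ₗ PP)
        (Representation.directSum ρ (SemidirectProduct.inl g) x)
        = symplQuotHom (blockHom g)
          ((genMap K (isoGenVec K 0) (isoGenVec K 1) (l - m) m ∘ₗ PP) x) := by
      intro g x
      rw [LinearMap.comp_apply, LinearMap.comp_apply, genMap_block, hPPb]
    have hr : ∀ σ x, (genMap K (isoGenVec K 0) (isoGenVec K 1) (l - m) m ∘ₗ PP)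
        (Representation.directSum ρ (SemidirectProduct.inr σ) x)
        = symplQuotHom (permHom σ)
          ((genMap K (isoGenVec K 0) (isoGenVec K 1) (l - m) m ∘ₗ PP) x) := by
      intro σ x
      have key : ∀ σ : Equiv.Perm (Fin 2), σ = 1 ∨ σ = Equiv.swap 0 1 := by decide
      rcases key σ with rfl | rfl
      · rw [map_one, map_one, map_one, Module.End.one_apply]
        obtain ⟨f, hf⟩ := Ideal.Quotient.mkₐ_surjective K (Ideal.span {symplForm K})
          ((genMap K (isoGenVec K 0) (isoGenVec K 1) (l - m) m ∘ₗ PP) x)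
        rw [← hf, symplQuotHom_mk, map_one, Module.End.one_apply]
      · rw [LinearMap.comp_apply, LinearMap.comp_apply, genMap_swap, hPPs]
    intro γ x
    have hγ : γ = SemidirectProduct.inl γ.left * SemidirectProduct.inr γ.right :=
      (SemidirectProduct.inl_left_mul_inr_right γ).symm
    rw [hγ, map_mul, map_mul, Module.End.mul_apply, hl, hr, wrHom_inl, wrHom_inr]
    obtain ⟨f, hf⟩ := Ideal.Quotient.mkₐ_surjective K (Ideal.span {symplForm K})
      ((genMap K (isoGenVec K 0) (isoGenVec K 1) (l - m) m ∘ₗ PP) x)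
    rw [← hf, symplQuotHom_mk, symplQuotHom_mk, symplQuotHom_mk, map_mul, Module.End.mul_apply]

end Criterion

/-! ### Tensor products of binary forms as bihomogeneous polynomials -/

section TensorMul

variable (K : Type*) [Field K]

/-- The inclusion of the index set of the `k`-th plane. -/
def planeEmb (k : Fin 2) : Fin 1 ⊕ Fin 1 → Fin 2 ⊕ Fin 2 :=
  Sum.map (fun _ => k) fun _ => k

/-- The exponents of bidegree `(a, b)` with respect to the two planes. -/
def colorSet (a b : ℕ) : Set (Fin 2 ⊕ Fin 2 →₀ ℕ) :=
  {κ | Finsupp.weight (colorWeight planeOf 0) κ = a ∧ Finsupp.weight (colorWeight planeOf 1) κ = b}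

/-- The product of functions on the two planes. -/
def planeMul : MvPolynomial (Fin 1 ⊕ Fin 1) K ⊗[K] MvPolynomial (Fin 1 ⊕ Fin 1) K →ₐ[K]
    MvPolynomial (Fin 2 ⊕ Fin 2) K :=
  Algebra.TensorProduct.productMap (rename (planeEmb 0)) (rename (planeEmb 1))

/-- The product of binary forms on the two planes. -/
def formMul (a b : ℕ) : VSpace K a ⊗[K] VSpace K b →ₗ[K] MvPolynomial (Fin 2 ⊕ Fin 2) K :=
  (planeMul K).toLinearMap ∘ₗ TensorProduct.map (VSpace K a).subtype (VSpace K b).subtype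

variable {K}

lemma formMul_tmul {a b : ℕ} (f : VSpace K a) (g : VSpace K b) :
    formMul K a b (f ⊗ₜ g) = rename (planeEmb 0) f.1 * rename (planeEmb 1) g.1 := by
  simp [formMul, planeMul]

/-- The two factors use disjoint sets of variables, and the tensor product of their polynomial rings
is the polynomial ring in the union. -/
lemma planeMul_injective : Function.Injective (planeMul K) := by
  have hinj : Function.Injective (Sum.elim (planeEmb 0) (planeEmb 1)) := by decide
  have e : planeMul K = (rename (Sum.elim (planeEmb 0) (planeEmb 1))).comp
      (tensorEquivSum K (Fin 1 ⊕ Fin 1) (Fin 1 ⊕ Fin 1) K).toAlgHom := by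
    apply Algebra.TensorProduct.ext
    · apply MvPolynomial.algHom_ext
      intro i
      simp [planeMul]
    · apply MvPolynomial.algHom_ext
      intro i
      simp [planeMul]
  rw [e]
  exact (rename_injective _ hinj).comp (AlgEquiv.injective _)

lemma formMul_injective (a b : ℕ) : Function.Injective (formMul K a b) :=
  planeMul_injective.comp (Module.Flat.tensorProduct_mapIncl_injective_of_right _ _)

lemma weight_mapDomain_planeEmb (k k' : Fin 2) (u : Fin 1 ⊕ Fin 1 →₀ ℕ) :
    Finsupp.weight (colorWeight planeOf k) (Finsupp.mapDomain (planeEmb k') u)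
      = if k' = k then u.degree else 0 := by
  have h : ∀ j, planeOf (planeEmb k' j) = k' := by
    intro j
    rcases j with j | j <;> rfl
  have hc : ∀ j, colorWeight planeOf k (planeEmb k' j) = if k' = k then 1 else 0 := by
    simp [colorWeight, h]
  rw [Finsupp.weight_apply, Finsupp.sum_mapDomain_index (by simp) (by simp [add_mul])]
  split_ifs with hk
  · simp only [hc, if_pos hk, smul_eq_mul, mul_one]
    rfl
  · simp [hc, hk]

lemma formMul_mem {a b : ℕ} (t : VSpace K a ⊗[K] VSpace K b) :
    formMul K a b t ∈ restrictSupport K (colorSet a b) := by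
  induction t using TensorProduct.induction_on with
  | zero => rw [map_zero]; exact Submodule.zero_mem _
  | add x y hx hy => rw [map_add]; exact Submodule.add_mem _ hx hy
  | tmul f g =>
    rw [formMul_tmul, mem_restrictSupport_iff]
    intro κ hκ
    classical
    obtain ⟨κ₁, h₁, κ₂, h₂, rfl⟩ := Finset.mem_add.1 (support_mul _ _ hκ)
    obtain ⟨u, rfl, hu⟩ := coeff_rename_ne_zero _ _ _ (mem_support_iff.1 h₁)
    obtain ⟨v, rfl, hv⟩ := coeff_rename_ne_zero _ _ _ (mem_support_iff.1 h₂)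
    have hu' : u.degree = a := by
      rw [Finsupp.degree_eq_weight_one]
      exact f.2 hu
    have hv' : v.degree = b := by
      rw [Finsupp.degree_eq_weight_one]
      exact g.2 hv
    simp [colorSet, weight_mapDomain_planeEmb, hu', hv']

lemma range_formMul (a b : ℕ) :
    LinearMap.range (formMul K a b) = restrictSupport K (colorSet a b) := by
  refine le_antisymm ?_ ?_
  · rintro _ ⟨t, rfl⟩
    exact formMul_mem t
  · rw [restrictSupport_eq_span, Submodule.span_le]
    rintro _ ⟨κ, ⟨h₀, h₁⟩, rfl⟩
    -- The exponent splits into its parts in the two planes, so the monomial is the product of one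
    -- binary monomial from each.
    let r : Fin 2 → (Fin 1 ⊕ Fin 1 →₀ ℕ) := fun k =>
      Finsupp.equivFunOnFinite.symm fun j => κ (planeEmb k j)
    have hκ : κ = Finsupp.mapDomain (planeEmb 0) (r 0) + Finsupp.mapDomain (planeEmb 1) (r 1) := by
      have hr : ∀ k, r k = Finsupp.single (.inl 0) (κ (.inl k)) +
          Finsupp.single (.inr 0) (κ (.inr k)) := by
        intro k
        ext j
        rcases j with j | j <;> fin_cases j <;> simp [r, planeEmb]
      rw [hr, hr]
      ext j
      rcases j with j | j <;> fin_cases j <;>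
        simp [Finsupp.mapDomain_add, Finsupp.mapDomain_single, planeEmb]
    have d0 : (r 0).degree = a := by
      rw [hκ, map_add, weight_mapDomain_planeEmb, weight_mapDomain_planeEmb] at h₀
      simpa using h₀
    have d1 : (r 1).degree = b := by
      rw [hκ, map_add, weight_mapDomain_planeEmb, weight_mapDomain_planeEmb] at h₁
      simpa using h₁
    refine ⟨⟨monomial (r 0) 1, ?_⟩ ⊗ₜ ⟨monomial (r 1) 1, ?_⟩, ?_⟩
    · exact isHomogeneous_monomial _ d0
    · exact isHomogeneous_monomial _ d1
    · rw [formMul_tmul, rename_monomial, rename_monomial, monomial_mul, ← hκ, mul_one]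

lemma rename_symRep (g : Fin 2 → Sp2 K) (k : Fin 2) (f : MvPolynomial (Fin 1 ⊕ Fin 1) K) :
    rename (planeEmb k) (symRep K _ (g k).1 f)
      = symRep K _ (blockHom g).1 (rename (planeEmb k) f) := by
  rw [symRep_eq_linSubst, symRep_eq_linSubst]
  have : (rename (planeEmb k)).comp (linSubst K (g k).1)
      = (linSubst K (blockHom g).1).comp (rename (planeEmb k)) := by
    apply MvPolynomial.algHom_ext
    intro j
    rw [AlgHom.comp_apply, AlgHom.comp_apply, rename_X, linSubst_X, linSubst_X]
    rcases j with j | j <;> fin_cases j <;> fin_cases k <;>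
      simp [blockHom, blockMatrix, planeEmb]
  exact DFunLike.congr_fun this f

lemma symRep_rename_swap (k : Fin 2) (f : MvPolynomial (Fin 1 ⊕ Fin 1) K) :
    symRep K _ (permHom (K := K) (Equiv.swap 0 1)).1 (rename (planeEmb k) f)
      = rename (R := K) (planeEmb (Equiv.swap 0 1 k)) f := by
  rw [symRep_eq_linSubst]
  have : (linSubst K (permHom (K := K) (Equiv.swap 0 1)).1).comp (rename (planeEmb k))
      = rename (planeEmb (Equiv.swap 0 1 k)) := by
    apply MvPolynomial.algHom_ext
    intro j
    rw [AlgHom.comp_apply, rename_X, linSubst_X, rename_X]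
    rcases j with j | j <;> fin_cases j <;> fin_cases k <;>
      simp [permHom, permMatrix, planeEmb, Equiv.Perm.permMatrix, PEquiv.toMatrix_apply]
  exact DFunLike.congr_fun this f

lemma symRep_mul {σ : Type*} [Fintype σ] [DecidableEq σ] (M : Matrix σ σ K)
    (f g : MvPolynomial σ K) : symRep K σ M (f * g) = symRep K σ M f * symRep K σ M g := by
  simp only [symRep_eq_linSubst, map_mul]

lemma formMul_VV {a b : ℕ} (g : Fin 2 → Sp2 K) (t : VSpace K a ⊗[K] VSpace K b) :
    formMul K a b (VV K a b g t) = symRep K _ (blockHom g).1 (formMul K a b t) := by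
  induction t using TensorProduct.induction_on with
  | zero => simp only [map_zero]
  | add x y hx hy => simp only [map_add, hx, hy]
  | tmul f h =>
    have e : VV K a b g (f ⊗ₜ h) = V K a (g 0) f ⊗ₜ V K b (g 1) h := rfl
    rw [e, formMul_tmul, formMul_tmul, symRep_mul, ← rename_symRep, ← rename_symRep]
    rfl

lemma formMul_comm {a b : ℕ} (t : VSpace K a ⊗[K] VSpace K b) :
    formMul K b a (TensorProduct.comm K _ _ t)
      = symRep K _ (permHom (Equiv.swap 0 1)).1 (formMul K a b t) := by
  induction t using TensorProduct.induction_on with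
  | zero => simp only [map_zero]
  | add x y hx hy => simp only [map_add, hx, hy]
  | tmul f h =>
    rw [TensorProduct.comm_tmul, formMul_tmul, formMul_tmul, symRep_mul, symRep_rename_swap,
      symRep_rename_swap, Equiv.swap_apply_left, Equiv.swap_apply_right, mul_comm]

end TensorMul

/-! ### Realizations of representations of the wreath product by polynomials -/

section Realizes

variable {K : Type*} [Field K]

/-- The map `P` realizes `ρ`, twisted by the sign `ε` of the transposition, on the polynomials
whose exponents lie in `s`. -/
structure Realizes {D : Type*} [AddCommMonoid D] [Module K D] (ρ : Representation K (Wr K) D)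
    (ε : K) (P : D →ₗ[K] MvPolynomial (Fin 2 ⊕ Fin 2) K) (s : Set (Fin 2 ⊕ Fin 2 →₀ ℕ)) :
    Prop where
  injective : Function.Injective P
  range : LinearMap.range P = restrictSupport K s
  block : ∀ g x, P (ρ (SemidirectProduct.inl g) x) = symRep K _ (blockHom g).1 (P x)
  swap : ∀ x, P (ρ (SemidirectProduct.inr (Equiv.swap 0 1)) x)
    = ε • symRep K _ (permHom (Equiv.swap 0 1)).1 (P x)

lemma Realizes.coeff_eq_zero {D : Type*} [AddCommMonoid D] [Module K D]
    {ρ : Representation K (Wr K) D} {ε : K} {P : D →ₗ[K] MvPolynomial (Fin 2 ⊕ Fin 2) K}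
    {s : Set (Fin 2 ⊕ Fin 2 →₀ ℕ)} (h : Realizes ρ ε P s) {κ : Fin 2 ⊕ Fin 2 →₀ ℕ} (hκ : κ ∉ s)
    (x : D) : coeff κ (P x) = 0 := by
  by_contra hne
  exact hκ ((mem_restrictSupport_iff K).1 (h.range.le ⟨x, rfl⟩) (mem_support_iff.2 hne))

/-- Disjointness of the exponent sets makes the sum direct: a coefficient with exponent in one set
sees only the corresponding component. -/
lemma Realizes.prod {D D' : Type*} [AddCommMonoid D] [Module K D] [AddCommMonoid D'] [Module K D']
    {ρ : Representation K (Wr K) D} {ρ' : Representation K (Wr K) D'} {ε : K}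
    {P : D →ₗ[K] MvPolynomial (Fin 2 ⊕ Fin 2) K} {P' : D' →ₗ[K] MvPolynomial (Fin 2 ⊕ Fin 2) K}
    {s s' : Set (Fin 2 ⊕ Fin 2 →₀ ℕ)} (h : Realizes ρ ε P s) (h' : Realizes ρ' ε P' s')
    (hs : Disjoint s s') : Realizes (ρ.prod ρ') ε (P.coprod P') (s ∪ s') where
  injective := by
    rintro ⟨x, x'⟩ ⟨y, y'⟩ hxy
    simp only [LinearMap.coprod_apply] at hxy
    refine Prod.ext (h.injective ?_) (h'.injective ?_)
    · ext κ
      by_cases hκ : κ ∈ s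
      · have := congrArg (coeff κ) hxy
        simpa [h'.coeff_eq_zero (Set.disjoint_left.1 hs hκ)] using this
      · rw [h.coeff_eq_zero hκ, h.coeff_eq_zero hκ]
    · ext κ
      by_cases hκ : κ ∈ s'
      · have := congrArg (coeff κ) hxy
        simpa [h.coeff_eq_zero (Set.disjoint_right.1 hs hκ)] using this
      · rw [h'.coeff_eq_zero hκ, h'.coeff_eq_zero hκ]
  range := by
    rw [LinearMap.range_coprod, h.range, h'.range, restrictSupport_eq_span,
      restrictSupport_eq_span, restrictSupport_eq_span, Set.image_union, Submodule.span_union]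
  block g x := by simp [h.block, h'.block]
  swap x := by simp [h.swap, h'.swap]

lemma Realizes.directSum {ι : Type*} {D : ι → Type*} [∀ i, AddCommMonoid (D i)]
    [∀ i, Module K (D i)] [DecidableEq ι] {ρ : ∀ i, Representation K (Wr K) (D i)} {ε : K}
    {P : ∀ i, D i →ₗ[K] MvPolynomial (Fin 2 ⊕ Fin 2) K} {s : ι → Set (Fin 2 ⊕ Fin 2 →₀ ℕ)}
    (h : ∀ i, Realizes (ρ i) ε (P i) (s i)) (hs : Pairwise fun i j => Disjoint (s i) (s j)) :
    Realizes (Representation.directSum ρ) ε (DirectSum.toModule K ι _ P) (⋃ i, s i) where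
  injective := by
    have key : ∀ (i : ι) (κ : Fin 2 ⊕ Fin 2 →₀ ℕ), κ ∈ s i → ∀ x,
        coeff κ (DirectSum.toModule K ι _ P x) = coeff κ (P i (x i)) := by
      intro i κ hκ x
      induction x using DirectSum.induction_on with
      | zero => simp
      | add x y hx hy => simp [hx, hy]
      | of j y =>
        change coeff κ (DirectSum.toModule K ι _ P (DirectSum.lof K ι D j y)) = _
        rw [DirectSum.toModule_lof]
        by_cases hij : j = i
        · subst hij
          simp
        · rw [DirectSum.of_eq_of_ne _ _ _ (Ne.symm hij), map_zero,
            (h j).coeff_eq_zero (Set.disjoint_right.1 (hs hij) hκ), coeff_zero]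
    intro x y hxy
    refine DFinsupp.ext fun i => (h i).injective ?_
    ext κ
    by_cases hκ : κ ∈ s i
    · exact (key i κ hκ x).symm.trans ((congrArg (coeff κ) hxy).trans (key i κ hκ y))
    · rw [(h i).coeff_eq_zero hκ, (h i).coeff_eq_zero hκ]
  range := by
    refine le_antisymm ?_ ?_
    · rintro _ ⟨x, rfl⟩
      induction x using DirectSum.induction_on with
      | zero => rw [map_zero]; exact Submodule.zero_mem _
      | add x y hx hy => rw [map_add]; exact Submodule.add_mem _ hx hy
      | of j y =>
        change DirectSum.toModule K ι _ P (DirectSum.lof K ι D j y) ∈ _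
        rw [DirectSum.toModule_lof]
        exact restrictSupport_mono K (Set.subset_iUnion s j) ((h j).range.le ⟨y, rfl⟩)
    · rw [restrictSupport_eq_span, Submodule.span_le]
      rintro _ ⟨κ, hκ, rfl⟩
      obtain ⟨i, hi⟩ := Set.mem_iUnion.1 hκ
      obtain ⟨x, hx⟩ := (h i).range.ge ((monomial_mem_restrictSupport K).2 (Or.inl hi) :
        monomial κ (1 : K) ∈ restrictSupport K (s i))
      exact ⟨DirectSum.lof K ι D i x, by rw [DirectSum.toModule_lof, hx]⟩
  block g x := by
    induction x using DirectSum.induction_on with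
    | zero => simp
    | add x y hx hy => simp only [map_add, hx, hy]
    | of j y =>
      change DirectSum.toModule K ι _ P (DirectSum.lmap (fun i => ρ i (SemidirectProduct.inl g))
        (DirectSum.lof K ι D j y)) = symRep K _ _ (DirectSum.toModule K ι _ P
          (DirectSum.lof K ι D j y))
      rw [DirectSum.lmap_lof, DirectSum.toModule_lof, DirectSum.toModule_lof, (h j).block]
  swap x := by
    induction x using DirectSum.induction_on with
    | zero => simp
    | add x y hx hy => simp only [map_add, hx, hy, smul_add]
    | of j y =>
      change DirectSum.toModule K ι _ P (DirectSum.lmap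
        (fun i => ρ i (SemidirectProduct.inr (Equiv.swap 0 1))) (DirectSum.lof K ι D j y))
        = ε • symRep K _ _ (DirectSum.toModule K ι _ P (DirectSum.lof K ι D j y))
      rw [DirectSum.lmap_lof, DirectSum.toModule_lof, DirectSum.toModule_lof, (h j).swap]

section WrRep

variable {X : Type*} [AddCommMonoid X] [Module K X]
    (ρ : Representation K (Fin 2 → Sp2 K) X) (T : X →ₗ[K] X) (hT : T * T = 1)
    (hρ : ∀ g : Fin 2 → Sp2 K, T * ρ g = ρ (fun i => g (Equiv.swap 0 1 i)) * T)

lemma wrRep_inl (g : Fin 2 → Sp2 K) (x : X) :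
    wrRep ρ T hT hρ (SemidirectProduct.inl g) x = ρ g x := by
  simp [wrRep]

lemma wrRep_swap (x : X) :
    wrRep ρ T hT hρ (SemidirectProduct.inr (Equiv.swap 0 1)) x = T x := by
  have hne : (Equiv.swap 0 1 : Equiv.Perm (Fin 2)) ≠ 1 := by decide
  simp [wrRep, hne]

end WrRep

lemma realizes_USign (ε : ℤˣ) (a : ℕ) :
    Realizes (USign K ε a) ((ε : ℤ) : K) (formMul K a a) (colorSet a a) where
  injective := formMul_injective a a
  range := range_formMul a a
  block g x := by rw [USign, wrRep_inl, formMul_VV]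
  swap x := by
    have e : swapSign K ε a x = ((ε : ℤ) : K) • TensorProduct.comm K _ _ x := by
      rw [swapSign, LinearMap.smul_apply]
      generalize (TensorProduct.comm K (VSpace K a) (VSpace K a)).toLinearMap x = y
      induction y using TensorProduct.induction_on with
      | zero => simp
      | add y z hy hz => rw [smul_add, hy, hz, smul_add]
      | tmul f g => rw [TensorProduct.smul_tmul', TensorProduct.smul_tmul', Int.cast_smul_eq_zsmul]
    rw [USign, wrRep_swap, e, map_smul, formMul_comm]

lemma disjoint_colorSet {a b a' b' : ℕ} (h : a ≠ a' ∨ b ≠ b') :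
    Disjoint (colorSet a b) (colorSet a' b') := by
  refine Set.disjoint_left.2 ?_
  rintro κ ⟨rfl, rfl⟩ ⟨h₀, h₁⟩
  rcases h with h | h
  · exact h h₀
  · exact h h₁

/-- Scaling the second component by ε twists the transposition by ε because ε² = 1, so `U` realizes
either sign. For a ≠ b the two components have disjoint exponents. -/
lemma realizes_U {ε : K} (hε : ε * ε = 1) {a b : ℕ} (hab : a ≠ b) :
    Realizes (U K a b) ε ((formMul K a b).coprod (ε • formMul K b a))
      (colorSet a b ∪ colorSet b a) where
  injective := by
    have hε0 : ε ≠ 0 := left_ne_zero_of_mul (hε ▸ one_ne_zero)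
    have hd := disjoint_colorSet (a := a) (b := b) (a' := b) (b' := a) (Or.inl hab)
    have hz : ∀ {a b : ℕ} {κ : Fin 2 ⊕ Fin 2 →₀ ℕ}, κ ∉ colorSet a b →
        ∀ t, coeff κ (formMul K a b t) = 0 := by
      intro a b κ hκ t
      by_contra hne
      exact hκ ((mem_restrictSupport_iff K).1 (formMul_mem t) (mem_support_iff.2 hne))
    rintro ⟨x, x'⟩ ⟨y, y'⟩ hxy
    simp only [LinearMap.coprod_apply, LinearMap.smul_apply] at hxy
    refine Prod.ext (formMul_injective a b ?_) (formMul_injective b a ?_)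
    · ext κ
      by_cases hκ : κ ∈ colorSet a b
      · have := congrArg (coeff κ) hxy
        simpa [hz (Set.disjoint_left.1 hd hκ)] using this
      · rw [hz hκ, hz hκ]
    · ext κ
      by_cases hκ : κ ∈ colorSet b a
      · have := congrArg (coeff κ) hxy
        simpa [hz (Set.disjoint_right.1 hd hκ), hε0] using this
      · rw [hz hκ, hz hκ]
  range := by
    have hε0 : ε ≠ 0 := left_ne_zero_of_mul (hε ▸ one_ne_zero)
    rw [LinearMap.range_coprod, LinearMap.range_smul _ _ hε0, range_formMul, range_formMul,
      restrictSupport_eq_span, restrictSupport_eq_span, restrictSupport_eq_span, Set.image_union,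
      Submodule.span_union]
  block g x := by
    rw [U, wrRep_inl]
    simp [formMul_VV]
  swap x := by
    rw [U, wrRep_swap]
    have e : swapU K a b x = (TensorProduct.comm K _ _ x.2, TensorProduct.comm K _ _ x.1) := rfl
    simp only [e, LinearMap.coprod_apply, LinearMap.smul_apply, formMul_comm, map_add, map_smul,
      smul_add, smul_smul, hε, one_smul]
    rw [add_comm]

end Realizes

/-! ### Matching the bidegrees with the summands -/

section Bidegrees

lemma mem_bideg_iff (n i : ℕ) (κ : Fin 2 ⊕ Fin 2 →₀ ℕ) :
    κ ∈ ⋃ j : {j : ℕ // 2 * j < n}, (colorSet (n + i - j) (i + j) ∪ colorSet (i + j) (n + i - j)) ↔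
    ∃ j, 2 * j < n ∧ ((Finsupp.weight (colorWeight planeOf 0) κ = n + i - j ∧
      Finsupp.weight (colorWeight planeOf 1) κ = i + j) ∨
      (Finsupp.weight (colorWeight planeOf 0) κ = i + j ∧
      Finsupp.weight (colorWeight planeOf 1) κ = n + i - j)) := by
  simp [colorSet]

/-- The bidegrees (n - b + i, b + i) come in mirror pairs b ↔ n - b, each indexed by its smaller
member j. The condition 2 * j < n expresses j < n/2 when n/2 is not an integer. -/
lemma iUnion_colorSet_of_odd {n : ℕ} (hn : Odd n) (i : ℕ) :
    (⋃ j : {j : ℕ // 2 * j < n}, (colorSet (n + i - j) (i + j) ∪ colorSet (i + j) (n + i - j)))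
      = {κ | ∃ b ≤ n, Finsupp.weight (colorWeight planeOf 0) κ = n - b + i ∧
        Finsupp.weight (colorWeight planeOf 1) κ = b + i} := by
  ext κ
  rw [mem_bideg_iff, Set.mem_ofPred_eq]
  obtain ⟨r, hr⟩ := hn
  constructor
  · rintro ⟨j, hj, h | h⟩
    · exact ⟨j, by omega, by omega, by omega⟩
    · exact ⟨n - j, by omega, by omega, by omega⟩
  · rintro ⟨b, hb, h₀, h₁⟩
    rcases lt_or_ge (2 * b) n with h | h
    · exact ⟨b, h, Or.inl ⟨by omega, by omega⟩⟩
    · exact ⟨n - b, by omega, Or.inr ⟨by omega, by omega⟩⟩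

/-- For even n the bidegree with b = n/2 is its own mirror image and supplies the summand `USign`.
-/
lemma iUnion_colorSet_of_even {n : ℕ} (hn : Even n) (i : ℕ) :
    colorSet (n / 2 + i) (n / 2 + i) ∪
      (⋃ j : {j : ℕ // 2 * j < n}, (colorSet (n + i - j) (i + j) ∪ colorSet (i + j) (n + i - j)))
      = {κ | ∃ b ≤ n, Finsupp.weight (colorWeight planeOf 0) κ = n - b + i ∧
        Finsupp.weight (colorWeight planeOf 1) κ = b + i} := by
  ext κ
  rw [Set.mem_union, mem_bideg_iff, Set.mem_ofPred_eq]
  obtain ⟨r, hr⟩ := hn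
  constructor
  · rintro (⟨h₀, h₁⟩ | ⟨j, hj, h | h⟩)
    · exact ⟨r, by omega, by omega, by omega⟩
    · exact ⟨j, by omega, by omega, by omega⟩
    · exact ⟨n - j, by omega, by omega, by omega⟩
  · rintro ⟨b, hb, h₀, h₁⟩
    rcases lt_trichotomy (2 * b) n with h | h | h
    · exact Or.inr ⟨b, h, Or.inl ⟨by omega, by omega⟩⟩
    · exact Or.inl ⟨by omega, by omega⟩
    · exact Or.inr ⟨n - b, by omega, Or.inr ⟨by omega, by omega⟩⟩

lemma pairwise_disjoint_colorSet (n i : ℕ) :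
    Pairwise fun j j' : {j : ℕ // 2 * j < n} =>
      Disjoint (colorSet (n + i - j) (i + j) ∪ colorSet (i + j) (n + i - j))
        (colorSet (n + i - j') (i + j') ∪ colorSet (i + j') (n + i - j')) := by
  rintro ⟨j, hj⟩ ⟨j', hj'⟩ hne
  have : j ≠ j' := fun h => hne (Subtype.ext h)
  simp only [Set.disjoint_union_left, Set.disjoint_union_right]
  refine ⟨⟨?_, ?_⟩, ?_, ?_⟩ <;> exact disjoint_colorSet (by omega)

end Bidegrees

section Summands

variable {K : Type*} [Field K]

lemma realizes_directSum_U {ε : K} (hε : ε * ε = 1) (n i : ℕ) :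
    Realizes (Representation.directSum fun j : {j : ℕ // 2 * j < n} => U K (n + i - j) (i + j)) ε
      (DirectSum.toModule K _ _ fun j : {j : ℕ // 2 * j < n} =>
        (formMul K (n + i - j) (i + j)).coprod (ε • formMul K (i + j) (n + i - j)))
      (⋃ j : {j : ℕ // 2 * j < n},
        (colorSet (n + i - j) (i + j) ∪ colorSet (i + j) (n + i - j))) :=
  Realizes.directSum (fun j => realizes_U hε (by have := j.2; omega))
    (pairwise_disjoint_colorSet n i)

lemma nonempty_equiv_of_realizes [CharZero K] {l m : ℕ} (hml : m ≤ l) {D : Fin (m + 1) → Type*}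
    [∀ i, AddCommMonoid (D i)] [∀ i, Module K (D i)] {ρ : ∀ i, Representation K (Wr K) (D i)}
    (h : ∀ i : Fin (m + 1), ∃ P, Realizes (ρ i) ((-1) ^ m) P
      {κ | ∃ b ≤ l - m, Finsupp.weight (colorWeight planeOf 0) κ = l - m - b + i ∧
        Finsupp.weight (colorWeight planeOf 1) κ = b + i}) :
    Nonempty (Representation.Equiv ((W K l m).comp wrHom) (Representation.directSum ρ)) := by
  choose P h using h
  exact nonempty_equiv_directSum hml ρ P (fun i => (h i).injective) (fun i => (h i).range)
    (fun i => (h i).block) fun i => (h i).swap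

end Summands

end SpBranching

end

/-! ### The branching rule -/

open SpBranching in
theorem mainTheorem3 (K : Type*) [Field K] [CharZero K] (l m : ℕ) (hml : m ≤ l) :
    (Even (l + m) →
      Nonempty (Representation.Equiv
        ((W K l m).comp wrHom)
        (Representation.directSum fun i : Fin (m + 1) =>
          Representation.prod
            (USign K ((-1) ^ m) ((l - m) / 2 + i))
            (Representation.directSum fun j : {j : ℕ // 2 * j < l - m} =>
              U K (l - m + i - j) (i + j))))) ∧
    (Odd (l + m) →
      Nonempty (Representation.Equiv
        ((W K l m).comp wrHom)
        (Representation.directSum fun i : Fin (m + 1) =>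
          Representation.directSum fun j : {j : ℕ // 2 * j < l - m} =>
            U K (l - m + i - j) (i + j)))) := by
  have hε : (-1 : K) ^ m * (-1) ^ m = 1 := by rw [← mul_pow]; simp
  refine ⟨fun h => nonempty_equiv_of_realizes hml fun i => ?_,
    fun h => nonempty_equiv_of_realizes hml fun i => ?_⟩
  · have hn : Even (l - m) := by
      rw [Nat.even_add] at h
      rw [Nat.even_sub hml]
      exact h
    rw [← iUnion_colorSet_of_even hn]
    have hU := realizes_USign (K := K) ((-1) ^ m) ((l - m) / 2 + i)
    have hc : (((((-1) ^ m : ℤˣ)) : ℤ) : K) = (-1) ^ m := by simp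
    rw [hc] at hU
    refine ⟨_, hU.prod (realizes_directSum_U hε (l - m) i)
      (Set.disjoint_iUnion_right.2 fun j => ?_)⟩
    have := j.2
    exact Set.disjoint_union_right.2
      ⟨disjoint_colorSet (by omega), disjoint_colorSet (by omega)⟩
  · have hn : Odd (l - m) := by
      rw [Nat.odd_add] at h
      rw [Nat.odd_sub hml]
      exact h
    rw [← iUnion_colorSet_of_odd hn]
    exact ⟨_, realizes_directSum_U hε (l - m) i⟩
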